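/- Let $Q$ be a smooth manifold with a mechanical Lagrangian $L=\tfrac12\kappa-U$ (with $\kappa$ a Riemannian metric and $U$ a smooth function) and a smooth constant-rank constraint distribution $D\subset TQ$. Put $\mathcal M=\kappa^\sharp(D)\subset T^*Q$ and let $X_{\rm nh}$ be the nonholonomic vector field on $\mathcal M$, defined by $\mathbf i_{X_{\rm nh}}\Omega_Q|_{\mathcal C}=dH|_{\mathcal C}$ with $X_{\rm nh}\in\mathcal C=\{v\in T\mathcal M: T\tau(v)\in D\}$, where $\tau:T^*Q\to Q$ is the projection, $\Omega_Q=-d\Theta_Q$ the canonical 2-form and $H$ the Hamiltonian of $L$. Let a Lie group $G$ (Lie algebra $\mathfrak g$) act smoothly, freely and properly on $Q$, preserving $L$ and $D$, and let $V$ be the tangent distribution to the $G$-orbits. Assume: * (dimension assumption) $T_qQ=D_q+V_q$ for all $q\in Q$; * (vertical symmetry condition) there are a distribution $W\subset V$ with $TQ=D\oplus W$ and a closed normal subgroup $G_W\subset G$ with $W_q=T_q(\mathrm{Orb}_{G_W}(q))$ for all $q$; * with $S=D\cap V$ of rank $k$, there are smooth $\zeta_1,\dots,\zeta_k:Q\to\mathfrak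 g$ with $(\zeta_i(q))_Q(q)\in S_q$ such that the functions $J_i=\mathbf i_{(\zeta_i)_{T^*Q}}\Theta_Q|_{\mathcal M}$ on $\mathcal M$ are $G$-invariant, conserved ($X_{\rm nh}(J_i)=0$), and functionally independent ($dJ_1,\dots,dJ_k$ are linearly independent at every point of $\mathcal M$). Let $\rho:Q\to\widetilde Q=Q/G_W$ and $\varrho:G\to F=G/G_W$ be the quotient manifold and the quotient Lie group, let $\mathfrak f$ be the Lie algebra of $F$, and let $F$ act on $\widetilde Q$ by $\varrho(g)\cdot\rho(q)=\rho(g\cdot q)$ and on $T^*\widetilde Q$ by cotangent lift. Let $\widetilde J:T^*\widetilde Q\to\mathfrak f^*$, $\langle\widetilde J(\alpha),\nu\rangle=(\mathbf i_{\nu_{T^*\widetilde Q}}\Theta_{\widetilde Q})(\alpha)$, be the canonical momentum map. Let $\eta_i:\widetilde Q\to\mathfrak f$ be given by $\eta_i(\rho(q))=T_e\varrho(\zeta_i(q))$, and let $\widetilde J_i(\alpha_x)=\langle\widetilde J(\alpha_x),\eta_i(x)\rangle$ for $\alpha_x\in T^*_x\widetilde Q$ be the partially reduced horizontal gauge momenta.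 Then the $\eta_i$ are well defined and form a basis of $\mathfrak f$ at each point of $\widetilde Q$. Let $\mu^1,\dots,\mu^k:\widetilde Q\to\mathfrak f^*$ be the dual basis, $\langle\mu^i(x),\eta_j(x)\rangle=\delta_{ij}$. For all $c_1,\dots,c_k\in\mathbb R$ and $\mu=\sum_i c_i\mu^i$, the set $\widetilde J^{-1}(\mu):=\{\alpha_x\in T^*\widetilde Q:\widetilde J(\alpha_x)=\mu(x)\}$ satisfies $$\widetilde J^{-1}(\mu)=\bigcap_{i=1}^k\widetilde J_i^{-1}(c_i),$$ and it is an $F$-invariant embedded submanifold of $T^*\widetilde Q$ of codimension $k$. Moreover, the connected components of the sets $\widetilde J^{-1}(\mu)$, for $\mu\in\operatorname{span}_{\mathbb R}\{\mu^1,\dots,\mu^k\}$, are the leaves of a smooth foliation of $T^*\widetilde Q$ of codimension $k$. -/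

import Mathlib

open scoped Manifold ContDiff Topology
open Bundle

noncomputable section

/-! ### Submanifolds, tangent vectors and foliations -/

/-- The vectors tangent to a subset `S` of a manifold at `x`: the velocities at time `0` of the
smooth curves `γ : (-ε, ε) → M` with values in `S` and `γ 0 = x`. For an embedded submanifold
this is its tangent space, seen inside the tangent space of `M`. -/
def tangentVectors {E H M : Type*} [NormedAddCommGroup E] [NormedSpace ℝ E] [TopologicalSpace H]
    (I : ModelWithCorners ℝ E H) [TopologicalSpace M] [ChartedSpace H M] (S : Set M) (x : M) :
    Set (TangentSpace I x) :=
  {v | ∃ (ε : ℝ) (γ : ℝ → M), 0 < ε ∧ γ 0 = x ∧ (∀ t ∈ Set.Ioo (-ε) ε, γ t ∈ S) ∧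
    ContMDiffOn 𝓘(ℝ, ℝ) I ∞ γ (Set.Ioo (-ε) ε) ∧
    (mfderiv 𝓘(ℝ, ℝ) I γ 0 : ℝ →L[ℝ] E) 1 = v}

/-- `S` is an embedded submanifold of codimension `k` of the manifold `M`: around each of its
points there is a chart of the smooth atlas in which `S` is a slice by an affine subspace of
codimension `k` (a fibre of a surjective linear map onto `ℝᵏ`). -/
def IsEmbeddedSubmanifold {E H M : Type*} [NormedAddCommGroup E] [NormedSpace ℝ E]
    [TopologicalSpace H] (I : ModelWithCorners ℝ E H) [TopologicalSpace M] [ChartedSpace H M]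
    (S : Set M) (k : ℕ) : Prop :=
  ∀ x ∈ S, ∃ φ ∈ IsManifold.maximalAtlas I ∞ M, x ∈ φ.source ∧
    ∃ p : E →L[ℝ] (Fin k → ℝ), Function.Surjective p ∧
      ∀ y ∈ φ.source, y ∈ S ↔ p (φ.extend I y) = p (φ.extend I x)

/-- The collection `ℱ` of subsets of `M` is (the set of leaves of) a smooth foliation of
codimension `k`: the leaves partition `M`, each leaf is path connected, and around every point
there is a flat chart, that is, a chart of the smooth atlas with convex image in which every leaf
is a (possibly empty) countable union of slices `{y | p y = c}`, where `p` is a fixed surjective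
linear map onto `ℝᵏ`. As a path in a countable union of slices stays in one slice of each flat
chart, path connectedness is the connectedness of the leaf as an immersed submanifold. -/
structure IsFoliation {E H M : Type*} [NormedAddCommGroup E] [NormedSpace ℝ E]
    [TopologicalSpace H] (I : ModelWithCorners ℝ E H) [TopologicalSpace M] [ChartedSpace H M]
    (ℱ : Set (Set M)) (k : ℕ) : Prop where
  partition : Setoid.IsPartition ℱ
  isPathConnected : ∀ L ∈ ℱ, IsPathConnected L
  flat_chart : ∀ x : M, ∃ φ ∈ IsManifold.maximalAtlas I ∞ M, x ∈ φ.source ∧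
    Convex ℝ (φ.extend I).target ∧
    ∃ p : E →L[ℝ] (Fin k → ℝ), Function.Surjective p ∧
      ∀ L ∈ ℱ, ∃ C : Set (Fin k → ℝ), C.Countable ∧
        ∀ y ∈ φ.source, y ∈ L ↔ p (φ.extend I y) ∈ C

/-- A smooth distribution of constant rank: near every point it is spanned by `r` smooth, pointwise
linearly independent vector fields. -/
def IsSmoothDistribution {E M : Type*} [NormedAddCommGroup E] [NormedSpace ℝ E]
    [TopologicalSpace M] [ChartedSpace E M] [IsManifold 𝓘(ℝ, E) ∞ M]
    (D : ∀ x : M, Submodule ℝ (TangentSpace 𝓘(ℝ, E) x)) : Prop :=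
  ∃ r : ℕ, ∀ x₀ : M, ∃ U : Set M, IsOpen U ∧ x₀ ∈ U ∧
    ∃ X : Fin r → ∀ x : M, TangentSpace 𝓘(ℝ, E) x,
      (∀ i, ContMDiffOn 𝓘(ℝ, E) 𝓘(ℝ, E).tangent ∞
        (fun x => (⟨x, X i x⟩ : TangentBundle 𝓘(ℝ, E) M)) U) ∧
      ∀ x ∈ U, LinearIndependent ℝ (fun i => X i x) ∧
        Submodule.span ℝ (Set.range fun i => X i x) = D x

/-! ### The cotangent bundle -/

/-- The cotangent bundle of a manifold modelled on the vector space `E`. -/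
abbrev CotangentBundle (E M : Type*) [NormedAddCommGroup E] [NormedSpace ℝ E]
    [TopologicalSpace M] [ChartedSpace E M] : Type _ :=
  TotalSpace (E →L[ℝ] ℝ) (fun x : M => TangentSpace 𝓘(ℝ, E) x →L[ℝ] Trivial M ℝ x)

/-- The model with corners (without boundary) of the cotangent bundle. -/
abbrev cotangentModel (E : Type*) [NormedAddCommGroup E] [NormedSpace ℝ E] :
    ModelWithCorners ℝ (E × (E →L[ℝ] ℝ)) (ModelProd E (E →L[ℝ] ℝ)) :=
  𝓘(ℝ, E).prod 𝓘(ℝ, E →L[ℝ] ℝ)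

section Cotangent

variable {E M : Type*} [NormedAddCommGroup E] [NormedSpace ℝ E]
  [TopologicalSpace M] [ChartedSpace E M] [IsManifold 𝓘(ℝ, E) ∞ M]

/-- The derivative of the projection `τ : T*M → M`. -/
def cotangentProjDeriv (α : CotangentBundle E M) :
    TangentSpace (cotangentModel E) α →L[ℝ] TangentSpace 𝓘(ℝ, E) α.proj :=
  mfderiv (cotangentModel E) 𝓘(ℝ, E) (fun β : CotangentBundle E M => β.proj) α

/-- The differential `df` at `α` of a real function `f` on `T*M`. -/
def cotangentDiff (f : CotangentBundle E M → ℝ) (α : CotangentBundle E M) :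
    TangentSpace (cotangentModel E) α →L[ℝ] ℝ :=
  mfderiv (cotangentModel E) 𝓘(ℝ, ℝ) f α

/-- The Liouville (canonical) 1-form `Θ` on `T*M`: `Θ_α(v) = α(Tτ v)`. -/
def liouvilleForm (α : CotangentBundle E M) : TangentSpace (cotangentModel E) α →L[ℝ] ℝ :=
  α.2 ∘L cotangentProjDeriv α

/-- The canonical 2-form `Ω = -dΘ` on `T*M`. In Mathlib the tangent space of `T*M` at `α` is
`E × E*`, through the preferred chart of `T*M` at `α`, which is the cotangent lift `(q, p)` of the
chart of `M` at `τ(α)`. In such coordinates `Ω = ∑ dqⁱ ∧ dpᵢ`. -/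
def canonicalTwoForm (α : CotangentBundle E M) (v w : TangentSpace (cotangentModel E) α) : ℝ :=
  let v' : E × (E →L[ℝ] ℝ) := v
  let w' : E × (E →L[ℝ] ℝ) := w
  w'.2 v'.1 - v'.2 w'.1

end Cotangent

/-! ### Group actions, cotangent lifts and momentum maps -/

section Action

variable {EG G : Type*} [NormedAddCommGroup EG] [NormedSpace ℝ EG] [TopologicalSpace G]
  [ChartedSpace EG G] [Group G]

/-- The infinitesimal generator `ξ ↦ ξ_X(x) = d/dt|₀ A (exp (t ξ)) x` of an action `A` of `G`
on `X`, i.e. the derivative at `1` of the orbit map `g ↦ A g x`. -/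
def infinitesimalGenerator {E H X : Type*} [NormedAddCommGroup E] [NormedSpace ℝ E]
    [TopologicalSpace H] (I : ModelWithCorners ℝ E H) [TopologicalSpace X] [ChartedSpace H X]
    (A : G → X → X) (x : X) : GroupLieAlgebra 𝓘(ℝ, EG) G →L[ℝ] TangentSpace I x :=
  -- the base point `A 1 x` of the derivative is `x`
  (mfderiv 𝓘(ℝ, EG) I (fun g => A g x) (1 : G) : EG →L[ℝ] E)

variable {E Q : Type*} [NormedAddCommGroup E] [NormedSpace ℝ E]
  [TopologicalSpace Q] [ChartedSpace E Q] [IsManifold 𝓘(ℝ, E) ∞ Q] [MulAction G Q]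

/-- The generator `ξ ↦ ξ_Q(q)` of the action of `G` on the configuration manifold `Q`. -/
def generator (q : Q) : GroupLieAlgebra 𝓘(ℝ, EG) G →L[ℝ] TangentSpace 𝓘(ℝ, E) q :=
  infinitesimalGenerator 𝓘(ℝ, E) (fun (g : G) (x : Q) => g • x) q

/-- The vertical space `V_q`, tangent at `q` to the `G`-orbit of `q`. -/
def verticalSpace (EG G : Type*) [NormedAddCommGroup EG] [NormedSpace ℝ EG] [TopologicalSpace G]
    [ChartedSpace EG G] [Group G] [MulAction G Q] (q : Q) :
    Submodule ℝ (TangentSpace 𝓘(ℝ, E) q) :=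
  LinearMap.range (generator (EG := EG) (G := G) q).toLinearMap

/-- The cotangent lift of the action: `g · α = α ∘ (T_q Ψ_g)⁻¹ ∈ T*_{gq} Q` for `α ∈ T*_q Q`. -/
def cotangentLift (g : G) (α : CotangentBundle E Q) : CotangentBundle E Q :=
  ⟨g • α.proj, α.2 ∘L (mfderiv 𝓘(ℝ, E) 𝓘(ℝ, E) (fun x : Q => g • x) α.proj).inverse⟩

/-- The canonical momentum map `⟨J(α), ν⟩ = (i_{ν_{T*Q}} Θ)(α)` of the cotangent lifted action. -/
def momentumMap (α : CotangentBundle E Q) : Module.Dual ℝ (GroupLieAlgebra 𝓘(ℝ, EG) G) :=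
  (liouvilleForm α ∘L infinitesimalGenerator (cotangentModel E)
    (fun (g : G) (β : CotangentBundle E Q) => cotangentLift g β) α).toLinearMap

/-- The function `J_ξ(α) = ⟨J(α), ξ(q)⟩ = (i_{ξ_{T*Q}} Θ)(α)`, `α ∈ T*_q Q`, attached to a
Lie algebra valued function `ξ` on `Q`. -/
def gaugeMomentum (ξ : Q → GroupLieAlgebra 𝓘(ℝ, EG) G) (α : CotangentBundle E Q) : ℝ :=
  momentumMap α (ξ α.proj)

/-- The set `{α ∈ T*_x Q | J(α) = μ(x)}` for a function `μ` with values in the dual of the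
Lie algebra. -/
def momentumLevelSet (μ : Q → Module.Dual ℝ (GroupLieAlgebra 𝓘(ℝ, EG) G)) :
    Set (CotangentBundle E Q) :=
  {α | momentumMap α = μ α.proj}

end Action

/-- The dual frame `μ¹, …, μᵏ` of a frame `η₁, …, ηₖ` of vector-valued functions:
`⟨μⁱ(x), η_j(x)⟩ = δᵢⱼ` (and `0` at the points where the `ηⱼ(x)` are not a basis). -/
def dualFrame {X V : Type*} [AddCommGroup V] [Module ℝ V] {k : ℕ} (η : Fin k → X → V)
    (i : Fin k) (x : X) : Module.Dual ℝ V :=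
  open Classical in
  if h : LinearIndependent ℝ (fun j => η j x) ∧
      ⊤ ≤ Submodule.span ℝ (Set.range fun j => η j x) then
    (Module.Basis.mk h.1 h.2).coord i
  else 0

/-! ### Nonholonomic systems with symmetries -/

/-- A nonholonomic system of mechanical type on `Q`: kinetic energy metric `κ`, potential `U` and
constraint distribution `D`. -/
structure NonholonomicSystem (E Q : Type*) [NormedAddCommGroup E] [NormedSpace ℝ E]
    [TopologicalSpace Q] [ChartedSpace E Q] [IsManifold 𝓘(ℝ, E) ∞ Q] where
  κ : ContMDiffRiemannianMetric 𝓘(ℝ, E) ∞ E (fun q : Q => TangentSpace 𝓘(ℝ, E) q)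
  U : Q → ℝ
  contMDiff_U : ContMDiff 𝓘(ℝ, E) 𝓘(ℝ, ℝ) ∞ U
  D : ∀ q : Q, Submodule ℝ (TangentSpace 𝓘(ℝ, E) q)
  isSmoothDistribution_D : IsSmoothDistribution D

namespace NonholonomicSystem

variable {E Q : Type*} [NormedAddCommGroup E] [NormedSpace ℝ E]
  [TopologicalSpace Q] [ChartedSpace E Q] [IsManifold 𝓘(ℝ, E) ∞ Q]

/-- The Lagrangian `L(v) = κ(v, v) / 2 - U`. -/
def lagrangian (𝒩 : NonholonomicSystem E Q) (v : TangentBundle 𝓘(ℝ, E) Q) : ℝ :=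
  (1 / 2) * 𝒩.κ.inner v.proj v.2 v.2 - 𝒩.U v.proj

/-- The Legendre transformation `TQ → T*Q`, `v ↦ κ(v, ·)`. -/
def legendre (𝒩 : NonholonomicSystem E Q) (v : TangentBundle 𝓘(ℝ, E) Q) :
    CotangentBundle E Q :=
  ⟨v.proj, 𝒩.κ.inner v.proj v.2⟩

/-- The Hamiltonian of the Lagrangian: `H(α) = α(u) / 2 + U` for the `u` with `κ(u, ·) = α`. -/
def hamiltonian (𝒩 : NonholonomicSystem E Q) (α : CotangentBundle E Q) : ℝ :=
  (1 / 2) * (α.2 ((𝒩.κ.inner α.proj).inverse α.2) : ℝ) + 𝒩.U α.proj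

/-- The constraint submanifold `ℳ` of `T*Q`, the image of `D` under the Legendre
transformation. -/
def constraintManifold (𝒩 : NonholonomicSystem E Q) : Set (CotangentBundle E Q) :=
  𝒩.legendre '' {v | v.2 ∈ 𝒩.D v.proj}

/-- The distribution `𝒞` on `ℳ`: the vectors tangent to `ℳ` that project into `D`. -/
def constraintVectors (𝒩 : NonholonomicSystem E Q) (m : CotangentBundle E Q) :
    Set (TangentSpace (cotangentModel E) m) :=
  {v | v ∈ tangentVectors (cotangentModel E) 𝒩.constraintManifold m ∧
    cotangentProjDeriv m v ∈ 𝒩.D m.proj}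

/-- `v` is the value at `m` of the nonholonomic vector field: `v ∈ 𝒞_m` and
`i_v Ω = dH` on `𝒞_m`. -/
def IsNonholonomicVector (𝒩 : NonholonomicSystem E Q) (m : CotangentBundle E Q)
    (v : TangentSpace (cotangentModel E) m) : Prop :=
  v ∈ 𝒩.constraintVectors m ∧ ∀ w ∈ 𝒩.constraintVectors m,
    canonicalTwoForm m v w = cotangentDiff 𝒩.hamiltonian m w

/-- The restriction to `ℳ` of the smooth function `f` on `T*Q` is conserved: `X_nh(f) = 0`. -/
def IsConserved (𝒩 : NonholonomicSystem E Q) (f : CotangentBundle E Q → ℝ) : Prop :=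
  ∀ m ∈ 𝒩.constraintManifold, ∀ v : TangentSpace (cotangentModel E) m,
    𝒩.IsNonholonomicVector m v → cotangentDiff f m v = 0

/-- The action of `G` is a symmetry: its tangent lift preserves the Lagrangian and `D`. -/
def IsSymmetry (𝒩 : NonholonomicSystem E Q) (G : Type*) [Group G] [MulAction G Q] : Prop :=
  ∀ g : G, (∀ v : TangentBundle 𝓘(ℝ, E) Q,
      𝒩.lagrangian (tangentMap 𝓘(ℝ, E) 𝓘(ℝ, E) (fun q : Q => g • q) v) = 𝒩.lagrangian v) ∧
    ∀ q : Q, ∀ v ∈ 𝒩.D q,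
      mfderiv 𝓘(ℝ, E) 𝓘(ℝ, E) (fun q : Q => g • q) q v ∈ 𝒩.D (g • q)

/-- The dimension assumption `T_q Q = D_q + V_q`. -/
def DimensionAssumption (𝒩 : NonholonomicSystem E Q) (EG G : Type*) [NormedAddCommGroup EG]
    [NormedSpace ℝ EG] [TopologicalSpace G] [ChartedSpace EG G] [Group G] [MulAction G Q] : Prop :=
  ∀ q : Q, 𝒩.D q ⊔ verticalSpace EG G q = ⊤

/-- `W` is a vertical complement of the constraints (`TQ = D ⊕ W`, `W ⊆ V`) that satisfies the
vertical symmetry condition with the closed normal subgroup `G_W`: `W_q` is the tangent space at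
`q` of the `G_W`-orbit of `q`. -/
structure VerticalSymmetryCondition (𝒩 : NonholonomicSystem E Q) (EG : Type*) {G : Type*}
    [NormedAddCommGroup EG] [NormedSpace ℝ EG] [TopologicalSpace G] [ChartedSpace EG G] [Group G]
    [MulAction G Q] (W : ∀ q : Q, Submodule ℝ (TangentSpace 𝓘(ℝ, E) q)) (GW : Subgroup G) :
    Prop where
  isCompl : ∀ q, IsCompl (𝒩.D q) (W q)
  le_vertical : ∀ q, W q ≤ verticalSpace EG G q
  isClosed : IsClosed (GW : Set G)
  normal : GW.Normal
  eq_tangent : ∀ q, (W q : Set (TangentSpace 𝓘(ℝ, E) q)) =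
    tangentVectors 𝓘(ℝ, E) (MulAction.orbit GW q) q

/-- `ζ₁, …, ζₖ` are smooth sections of `𝔤_S` (where `S = D ∩ V` has rank `k`) such that the
functions `Jᵢ = J_{ζᵢ}` on `ℳ` are `G`-invariant, functionally independent horizontal gauge
momenta. -/
structure IsHorizontalGaugeSymmetryBasis (𝒩 : NonholonomicSystem E Q) {EG G : Type*}
    [NormedAddCommGroup EG] [NormedSpace ℝ EG] [TopologicalSpace G] [ChartedSpace EG G] [Group G]
    [MulAction G Q] {k : ℕ} (ζ : Fin k → Q → GroupLieAlgebra 𝓘(ℝ, EG) G) : Prop where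
  rank_eq : ∀ q : Q, Module.finrank ℝ ↥(𝒩.D q ⊓ verticalSpace EG G q) = k
  contMDiff : ∀ i, ContMDiff (M' := EG) 𝓘(ℝ, E) 𝓘(ℝ, EG) ∞ (ζ i)
  mem : ∀ i q, generator q (ζ i q) ∈ 𝒩.D q ⊓ verticalSpace EG G q
  conserved : ∀ i, 𝒩.IsConserved (gaugeMomentum (ζ i))
  invariant : ∀ i, ∀ g : G, ∀ m ∈ 𝒩.constraintManifold,
    gaugeMomentum (ζ i) (cotangentLift g m) = gaugeMomentum (ζ i) m
  independent : ∀ m ∈ 𝒩.constraintManifold, ∀ a : Fin k → ℝ,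
    (∀ v ∈ tangentVectors (cotangentModel E) 𝒩.constraintManifold m,
      ∑ i, a i * cotangentDiff (gaugeMomentum (ζ i)) m v = 0) →
    a = 0

end NonholonomicSystem

/-! ### Reduction by the normal subgroup -/

/-- `ρ : Q → Q'` and `pr : G → F` exhibit the manifold `Q'` as the orbit manifold `Q / G_W` and the
Lie group `F` as the quotient `G / G_W`, each with its quotient smooth structure (the projection
is a submersion), and the `F`-action on `Q'` is the one induced by the `G`-action on `Q`. -/
structure IsReduction {EG G E Q EF F E' Q' : Type*}
    [NormedAddCommGroup EG] [NormedSpace ℝ EG] [TopologicalSpace G] [ChartedSpace EG G] [Group G]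
    [NormedAddCommGroup E] [NormedSpace ℝ E] [TopologicalSpace Q] [ChartedSpace E Q]
    [NormedAddCommGroup EF] [NormedSpace ℝ EF] [TopologicalSpace F] [ChartedSpace EF F] [Group F]
    [NormedAddCommGroup E'] [NormedSpace ℝ E'] [TopologicalSpace Q'] [ChartedSpace E' Q']
    [MulAction G Q] [MulAction F Q'] (GW : Subgroup G) (ρ : Q → Q') (pr : G →* F) : Prop where
  isSubmersion_base : Manifold.IsSubmersion 𝓘(ℝ, E) 𝓘(ℝ, E') ∞ ρ
  surjective_base : Function.Surjective ρ
  base_eq_iff : ∀ q₁ q₂ : Q, ρ q₁ = ρ q₂ ↔ q₁ ∈ MulAction.orbit GW q₂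
  isSubmersion_group : Manifold.IsSubmersion 𝓘(ℝ, EG) 𝓘(ℝ, EF) ∞ pr
  surjective_group : Function.Surjective pr
  ker_eq : pr.ker = GW
  equivariant : ∀ (g : G) (q : Q), ρ (g • q) = pr g • ρ q

/-- The Lie algebra homomorphism `T_1 pr : 𝔤 → 𝔣` of a homomorphism `pr` of Lie groups. -/
def lieProjection {EG G EF F : Type*} [NormedAddCommGroup EG] [NormedSpace ℝ EG]
    [TopologicalSpace G] [ChartedSpace EG G] [Group G] [NormedAddCommGroup EF] [NormedSpace ℝ EF]
    [TopologicalSpace F] [ChartedSpace EF F] [Group F] (pr : G →* F) :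
    GroupLieAlgebra 𝓘(ℝ, EG) G →L[ℝ] GroupLieAlgebra 𝓘(ℝ, EF) F :=
  -- the base point `pr 1` of the derivative is `1`
  (mfderiv 𝓘(ℝ, EG) 𝓘(ℝ, EF) pr (1 : G) : EG →L[ℝ] EF)

/-- The `𝔣`-valued function `η` on `Q' = Q / G_W` induced by the `𝔤`-valued function `ζ` on `Q`:
`η(x) = T_1 pr (ζ(q))` for a point `q` over `x`. -/
def reducedSymmetry {EG G Q EF F Q' : Type*} [NormedAddCommGroup EG] [NormedSpace ℝ EG]
    [TopologicalSpace G] [ChartedSpace EG G] [Group G] [NormedAddCommGroup EF] [NormedSpace ℝ EF]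
    [TopologicalSpace F] [ChartedSpace EF F] [Group F] (pr : G →* F) {ρ : Q → Q'}
    (hρ : Function.Surjective ρ) (ζ : Q → GroupLieAlgebra 𝓘(ℝ, EG) G) (x : Q') :
    GroupLieAlgebra 𝓘(ℝ, EF) F :=
  lieProjection pr (ζ (Function.surjInv hρ x))

end

/-! Let Yᵢ be the vector field on Q/G_W generated by ηᵢ. The momentum map pairs a covector with
generators, ⟨J̃(α), ν⟩ = α(ν_Q̃) (`momentumMap_apply`). Evaluating J̃(α) = Σ cᵢ μⁱ on the basis ηⱼ
therefore turns it into the scalar equations α(Yⱼ) = cⱼ. The level sets are thus exactly the fibres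
of one map α ↦ (α(Yᵢ))ᵢ into ℝᵏ (`pairings`). Since the Yᵢ are linearly independent, this map is a
submersion already along the cotangent fibres (`surjective_mfderiv_pairings`). Straightening it in
charts gives the codimension-k submanifolds and the foliation
(`ContMDiff.isEmbeddedSubmanifold_fiber`, `ContMDiff.isFoliation_fibers`). The fibres are
F-invariant because the Yᵢ are (`cotangentLift_pairing`).

The rest of the work produces this frame. Let Zᵢ be the vector field on Q generated by ζᵢ.
Invariance of D and of the Jᵢ on ℳ, with κ positive definite on D, forces Zᵢ to be G-invariant
(`generator_smul`). Since F acts freely on Q/G_W, its generators are injective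
(`generator_injective`), so ηᵢ does not depend on the point chosen in a fibre of ρ. Functional
independence of the Jᵢ, tested at zero covectors, makes the Zᵢ independent
(`linearIndependent_generator`). The kernel of Tρ is W, so D ∩ W = 0 keeps the ηᵢ independent, while
TQ = D ⊕ W with W ⊆ V and rank S = k makes them span 𝔣 (`linearIndependent_lieProjection`,
`span_lieProjection`). -/

set_option linter.unusedSectionVars false

noncomputable section

/-! ### Submersions: local sections and vectors tangent to fibres -/

section Submersion

variable {E M E' N : Type*} [NormedAddCommGroup E] [NormedSpace ℝ E]
  [TopologicalSpace M] [ChartedSpace E M]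
  [NormedAddCommGroup E'] [NormedSpace ℝ E']
  [TopologicalSpace N] [ChartedSpace E' N]

/-- A submersion has smooth local sections through every point. -/
theorem Manifold.IsSubmersionAt.exists_section [IsManifold 𝓘(ℝ, E) ∞ M]
    [IsManifold 𝓘(ℝ, E') ∞ N] {f : M → N} {x : M}
    (h : Manifold.IsSubmersionAt 𝓘(ℝ, E) 𝓘(ℝ, E') ∞ f x) :
    ∃ σ : N → M, ContMDiffAt 𝓘(ℝ, E') 𝓘(ℝ, E) ∞ σ (f x) ∧ σ (f x) = x ∧
      ∀ᶠ y in 𝓝 (f x), f (σ y) = y := by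
  have hw := h.writtenInCharts
  have hsrc := h.source_subset_preimage_source
  have hx := h.mem_domChart_source
  have hfx := h.mem_codChart_source
  have hφ := h.domChart_mem_maximalAtlas
  have hψ := h.codChart_mem_maximalAtlas
  set φ := h.domChart
  set ψ := h.codChart
  set e := h.equiv
  have hw' : ∀ z ∈ φ.target, ψ (f (φ.symm z)) = (e z).1 := by
    intro z hz
    have := hw (x := z) (by simpa using hz)
    simpa using this
  have h1 : (e (φ x)).1 = ψ (f x) := by
    rw [← hw' _ (φ.map_source hx), φ.left_inv hx]
  have h0 : e.symm (ψ (f x), (e (φ x)).2) = φ x := by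
    rw [← h1]; exact e.symm_apply_apply _
  have hψs : ContMDiffAt 𝓘(ℝ, E') 𝓘(ℝ, E') ∞ ψ (f x) :=
    contMDiffAt_of_mem_maximalAtlas hψ hfx
  have hg : ContMDiffAt 𝓘(ℝ, E') 𝓘(ℝ, E) ∞ (fun y => e.symm (ψ y, (e (φ x)).2)) (f x) :=
    (e.symm.contDiff.contMDiff.contMDiffAt).comp (f x)
      (hψs.prodMk_space contMDiffAt_const)
  -- In the normal form the submersion is the first projection of a product; the section freezes the
  -- complementary coordinate at its value at `x`.
  refine ⟨fun y => φ.symm (e.symm (ψ y, (e (φ x)).2)), ?_, ?_, ?_⟩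
  · refine ContMDiffAt.comp (f x) (g := φ.symm) ?_ hg
    rw [h0]
    exact contMDiffAt_symm_of_mem_maximalAtlas hφ (φ.map_source hx)
  · simp only [h0]
    exact φ.left_inv hx
  · have ht : ∀ᶠ y in 𝓝 (f x), e.symm (ψ y, (e (φ x)).2) ∈ φ.target :=
      hg.continuousAt (φ.open_target.mem_nhds (by rw [h0]; exact φ.map_source hx))
    filter_upwards [ht, ψ.open_source.mem_nhds hfx] with y hy hyψ
    apply ψ.injOn (hsrc (φ.map_target hy)) hyψ
    rw [hw' _ hy, e.apply_symm_apply]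

/-- The kernel of the derivative of a submersion is tangent to the fibre. -/
theorem Manifold.IsSubmersionAt.mem_tangentVectors_fiber [IsManifold 𝓘(ℝ, E) ∞ M]
    [IsManifold 𝓘(ℝ, E') ∞ N] {f : M → N} {x : M}
    (h : Manifold.IsSubmersionAt 𝓘(ℝ, E) 𝓘(ℝ, E') ∞ f x) {v : TangentSpace 𝓘(ℝ, E) x}
    (hv : mfderiv 𝓘(ℝ, E) 𝓘(ℝ, E') f x v = 0) :
    v ∈ tangentVectors 𝓘(ℝ, E) (f ⁻¹' {f x}) x := by
  have hw := h.writtenInCharts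
  have hsrc := h.source_subset_preimage_source
  have hx := h.mem_domChart_source
  have hfx := h.mem_codChart_source
  have hφ := h.domChart_mem_maximalAtlas
  have hψ := h.codChart_mem_maximalAtlas
  have hf := h.contMDiffAt
  set φ := h.domChart
  set ψ := h.codChart
  set e := h.equiv
  have hw' : ∀ z ∈ φ.target, ψ (f (φ.symm z)) = (e z).1 := by
    intro z hz
    have := hw (x := z) (by simpa using hz)
    simpa using this
  have hφs : ContMDiffAt 𝓘(ℝ, E) 𝓘(ℝ, E) ∞ φ x := contMDiffAt_of_mem_maximalAtlas hφ hx
  have hφi : ContMDiffAt 𝓘(ℝ, E) 𝓘(ℝ, E) ∞ φ.symm (φ x) :=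
    contMDiffAt_symm_of_mem_maximalAtlas hφ (φ.map_source hx)
  have hψs : ContMDiffAt 𝓘(ℝ, E') 𝓘(ℝ, E') ∞ ψ (f x) :=
    contMDiffAt_of_mem_maximalAtlas hψ hfx
  have ne : (∞ : WithTop ℕ∞) ≠ 0 := by simp
  -- The curve will be the straight line in the chart with direction `w`. It stays in the fibre
  -- because `w` has no component along the base factor, which is what `hv` says in the normal form.
  let w : E := mfderiv 𝓘(ℝ, E) 𝓘(ℝ, E) φ x v
  have hew : (e w).1 = 0 := by
    have h1 : HasMFDerivAt 𝓘(ℝ, E) 𝓘(ℝ, E') (ψ ∘ f) x _ :=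
      (hψs.mdifferentiableAt ne).hasMFDerivAt.comp x (hf.mdifferentiableAt ne).hasMFDerivAt
    have h2 : HasMFDerivAt 𝓘(ℝ, E) 𝓘(ℝ, E') ((fun z => (e z).1) ∘ φ) x _ :=
      HasMFDerivAt.comp x (g := fun z => (e z).1)
        (((ContinuousLinearMap.fst ℝ E' h.complement) ∘L (e : E →L[ℝ] E' × h.complement)).hasMFDerivAt)
        (hφs.mdifferentiableAt ne).hasMFDerivAt
    have h3 : (ψ ∘ f) =ᶠ[𝓝 x] ((fun z => (e z).1) ∘ φ) := by
      filter_upwards [φ.open_source.mem_nhds hx] with y hy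
      simp only [Function.comp]
      rw [← hw' _ (φ.map_source hy), φ.left_inv hy]
    have h4 := hasMFDerivAt_unique (h2.congr_of_eventuallyEq h3) h1
    have h5 := DFunLike.congr_fun h4 v
    have h6 : (e w).1 = mfderiv 𝓘(ℝ, E') 𝓘(ℝ, E') ψ (f x) (mfderiv 𝓘(ℝ, E) 𝓘(ℝ, E') f x v) := h5
    rw [h6, hv]
    exact map_zero _
  have hc : Continuous fun t : ℝ => φ x + t • w := by fun_prop
  have hopen : IsOpen {t : ℝ | φ x + t • w ∈ φ.target} := φ.open_target.preimage hc
  have h0 : (0 : ℝ) ∈ {t : ℝ | φ x + t • w ∈ φ.target} := by simpa using φ.map_source hx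
  obtain ⟨ε, hε, hball⟩ := Metric.isOpen_iff.1 hopen 0 h0
  rw [Real.ball_eq_Ioo, zero_sub, zero_add] at hball
  refine ⟨ε, fun t => φ.symm (φ x + t • w), hε, by simpa using φ.left_inv hx, ?_, ?_, ?_⟩
  · intro t ht
    have htt := hball ht
    apply ψ.injOn (hsrc (φ.map_target htt)) hfx
    rw [hw' _ htt, map_add, map_smul, Prod.fst_add, Prod.smul_fst, hew, smul_zero, add_zero,
      ← hw' _ (φ.map_source hx), φ.left_inv hx]
  · refine (contMDiffOn_symm_of_mem_maximalAtlas hφ).comp (t := φ.target) ?_ hball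
    apply ContDiff.contMDiff _ |>.contMDiffOn
    fun_prop
  · have hl : HasMFDerivAt 𝓘(ℝ, ℝ) 𝓘(ℝ, E) (fun t : ℝ => φ x + t • w) 0
        ((ContinuousLinearMap.id ℝ ℝ).smulRight w) := by
      apply HasFDerivAt.hasMFDerivAt
      exact (((ContinuousLinearMap.id ℝ ℝ).smulRight w).hasFDerivAt).const_add (φ x)
    have hi : HasMFDerivAt 𝓘(ℝ, E) 𝓘(ℝ, E) φ.symm (φ x + (0 : ℝ) • w)
        (mfderiv 𝓘(ℝ, E) 𝓘(ℝ, E) φ.symm (φ x) : E →L[ℝ] E) := by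
      have : φ x + (0 : ℝ) • w = φ x := by simp
      rw [this]
      exact (hφi.mdifferentiableAt ne).hasMFDerivAt
    have hcomp := hi.comp (0 : ℝ) hl
    have hm := hcomp.mfderiv
    have hid : HasMFDerivAt 𝓘(ℝ, E) 𝓘(ℝ, E) (φ.symm ∘ φ) x _ :=
      (hφi.mdifferentiableAt ne).hasMFDerivAt.comp x (hφs.mdifferentiableAt ne).hasMFDerivAt
    have hid' : HasMFDerivAt 𝓘(ℝ, E) 𝓘(ℝ, E) (φ.symm ∘ φ) x (ContinuousLinearMap.id ℝ _) := by
      refine (hasMFDerivAt_id x).congr_of_eventuallyEq ?_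
      filter_upwards [φ.open_source.mem_nhds hx] with y hy using φ.left_inv hy
    have h5 := DFunLike.congr_fun (hasMFDerivAt_unique hid hid') v
    have h6 : (mfderiv 𝓘(ℝ, ℝ) 𝓘(ℝ, E) (φ.symm ∘ fun t : ℝ => φ x + t • w) 0 : ℝ →L[ℝ] E) 1
        = (mfderiv 𝓘(ℝ, E) 𝓘(ℝ, E) φ.symm (φ x) : E →L[ℝ] E) ((1 : ℝ) • w) := 
      DFunLike.congr_fun hm (1 : ℝ)
    refine h6.trans ?_
    rw [one_smul]
    exact h5

end Submersion

/-! ### Differentiating along tangent vectors of a subset -/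

section Tangent

variable {E H M E' H' N : Type*} [NormedAddCommGroup E] [NormedSpace ℝ E] [TopologicalSpace H]
  {I : ModelWithCorners ℝ E H} [TopologicalSpace M] [ChartedSpace H M]
  [NormedAddCommGroup E'] [NormedSpace ℝ E'] [TopologicalSpace H']
  {J : ModelWithCorners ℝ E' H'} [TopologicalSpace N] [ChartedSpace H' N]

/-- The derivative of a map along a vector tangent to a set on which it agrees with another map. -/
theorem mfderiv_eq_of_mem_tangentVectors {S : Set M} {x : M} {v : TangentSpace I x}
    (hv : v ∈ tangentVectors I S x) {f g : M → N} (hf : MDifferentiableAt I J f x)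
    (hg : MDifferentiableAt I J g x) (hfg : ∀ y ∈ S, f y = g y) :
    (mfderiv I J f x v : E') = mfderiv I J g x v := by
  obtain ⟨ε, γ, hε, h0, hS, hγ, rfl⟩ := hv
  have hmem : Set.Ioo (-ε) ε ∈ 𝓝 (0 : ℝ) := Ioo_mem_nhds (by linarith) hε
  have hγ' : MDifferentiableAt 𝓘(ℝ, ℝ) I γ 0 :=
    (hγ.contMDiffAt hmem).mdifferentiableAt (by simp)
  subst h0
  have h1 := hf.hasMFDerivAt.comp (0 : ℝ) hγ'.hasMFDerivAt
  have h2 := hg.hasMFDerivAt.comp (0 : ℝ) hγ'.hasMFDerivAt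
  have h3 : g ∘ γ =ᶠ[𝓝 0] f ∘ γ := by
    filter_upwards [hmem] with t ht using (hfg _ (hS t ht)).symm
  have h4 := hasMFDerivAt_unique (h1.congr_of_eventuallyEq h3) (h2)
  exact DFunLike.congr_fun h4 (1 : ℝ)

end Tangent

/-! ### Smooth actions and the generators of free actions -/

section SmoothAction

variable {EG G E Q : Type*}
  [NormedAddCommGroup EG] [NormedSpace ℝ EG] [TopologicalSpace G] [ChartedSpace EG G] [Group G]
  [LieGroup 𝓘(ℝ, EG) ∞ G]
  [NormedAddCommGroup E] [NormedSpace ℝ E] [TopologicalSpace Q] [ChartedSpace E Q]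
  [IsManifold 𝓘(ℝ, E) ∞ Q] [MulAction G Q]

variable (EG E) in
theorem contMDiff_smul_left [ContMDiffSMul 𝓘(ℝ, EG) 𝓘(ℝ, E) ∞ G Q] (q : Q) :
    ContMDiff 𝓘(ℝ, EG) 𝓘(ℝ, E) ∞ (fun g : G => g • q) :=
  (ContMDiffSMul.contMDiff_smul (I := 𝓘(ℝ, EG)) (I' := 𝓘(ℝ, E)) (n := ∞) (G := G) (M := Q)).comp
    (contMDiff_id.prodMk contMDiff_const)

variable (EG E) in
theorem contMDiff_smul_right [ContMDiffSMul 𝓘(ℝ, EG) 𝓘(ℝ, E) ∞ G Q] (g : G) :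
    ContMDiff 𝓘(ℝ, E) 𝓘(ℝ, E) ∞ (fun q : Q => g • q) :=
  (ContMDiffSMul.contMDiff_smul (I := 𝓘(ℝ, EG)) (I' := 𝓘(ℝ, E)) (n := ∞) (G := G) (M := Q)).comp
    (contMDiff_const.prodMk contMDiff_id)

variable (EG) in
theorem mfderiv_inv_smul_comp [ContMDiffSMul 𝓘(ℝ, EG) 𝓘(ℝ, E) ∞ G Q] (g : G) (q : Q) :
    (mfderiv 𝓘(ℝ, E) 𝓘(ℝ, E) (fun x : Q => g⁻¹ • x) (g • q) : E →L[ℝ] E) ∘L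
      (mfderiv 𝓘(ℝ, E) 𝓘(ℝ, E) (fun x : Q => g • x) q : E →L[ℝ] E) =
      ContinuousLinearMap.id ℝ E := by
  have h1 := ((contMDiff_smul_right EG E g⁻¹).mdifferentiableAt (x := g • q)
    (by simp)).hasMFDerivAt.comp q
    ((contMDiff_smul_right EG E g).mdifferentiableAt (x := q) (by simp)).hasMFDerivAt
  have h2 : ((fun x : Q => g⁻¹ • x) ∘ fun x : Q => g • x) = id := by ext x; simp
  rw [h2] at h1
  exact hasMFDerivAt_unique h1 (hasMFDerivAt_id q)

variable (EG) in
theorem mfderiv_comp_inv_smul [ContMDiffSMul 𝓘(ℝ, EG) 𝓘(ℝ, E) ∞ G Q] (g : G) (q : Q) :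
    (mfderiv 𝓘(ℝ, E) 𝓘(ℝ, E) (fun x : Q => g • x) q : E →L[ℝ] E) ∘L
      (mfderiv 𝓘(ℝ, E) 𝓘(ℝ, E) (fun x : Q => g⁻¹ • x) (g • q) : E →L[ℝ] E) =
      ContinuousLinearMap.id ℝ E := by
  have h := mfderiv_inv_smul_comp EG (E := E) g⁻¹ (g • q)
  rwa [inv_inv, inv_smul_smul] at h

-- Since `ContinuousLinearMap.inverse` takes the default value `0` on non-invertible maps, both
-- one-sided identities are needed to replace it by the derivative of the inverse diffeomorphism.
variable (EG) in
theorem mfderiv_smul_inverse [ContMDiffSMul 𝓘(ℝ, EG) 𝓘(ℝ, E) ∞ G Q] (g : G) (q : Q) :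
    ((mfderiv 𝓘(ℝ, E) 𝓘(ℝ, E) (fun x : Q => g • x) q).inverse : E →L[ℝ] E) =
      (mfderiv 𝓘(ℝ, E) 𝓘(ℝ, E) (fun x : Q => g⁻¹ • x) (g • q) : E →L[ℝ] E) :=
  ContinuousLinearMap.inverse_eq (mfderiv_comp_inv_smul EG g q) (mfderiv_inv_smul_comp EG g q)

/-- The infinitesimal generators of a free action vanish nowhere. -/
theorem generator_injective [FiniteDimensional ℝ EG] [ContMDiffSMul 𝓘(ℝ, EG) 𝓘(ℝ, E) ∞ G Q]
    (hfree : ∀ (g : G) (q : Q), g • q = q → g = 1) (q : Q) :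
    Function.Injective (generator (EG := EG) (G := G) (E := E) q) := by
  rw [injective_iff_map_eq_zero]
  intro ξ hξ
  have : LieGroup 𝓘(ℝ, EG) (minSmoothness ℝ 3) G := by
    simp only [minSmoothness_of_isRCLikeNormedField]
    exact LieGroup.of_le (n := ∞) ENat.LEInfty.out
  have hV : ContMDiff 𝓘(ℝ, EG) 𝓘(ℝ, EG).tangent 1
      (fun g : G => (mulInvariantVectorField ξ g : TangentBundle 𝓘(ℝ, EG) G)) :=
    (contMDiff_mulInvariantVectorField ξ).of_le (by
      simp only [minSmoothness_of_isRCLikeNormedField]; exact one_le_two)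
  -- A local integral curve of the left-invariant field of ξ through 1 plays the role of exp(tξ).
  obtain ⟨γ, h0, hγ⟩ :=
    exists_isMIntegralCurveAt_of_contMDiffAt_boundaryless (0 : ℝ) (hV.contMDiffAt (x := (1 : G)))
  have horb : IsMIntegralCurveAt (I := 𝓘(ℝ, E)) (fun t => γ t • q)
      (fun _ => (0 : TangentSpace 𝓘(ℝ, E) _)) 0 := by
    filter_upwards [hγ] with t ht
    have hc := ((contMDiff_smul_left EG E q).mdifferentiableAt (x := γ t)
      (by simp)).hasMFDerivAt.comp t ht
    refine hc.congr_mfderiv ?_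
    -- Because (γ(t)h)·q = γ(t)·(h·q), the velocity of γ(t)·q is the image of ξ_Q(q) = 0 under the
    -- derivative of γ(t), so it vanishes for all small t and not only at t = 0.
    have hfun : (fun g : G => g • q) ∘ (fun h => γ t * h) =
        (fun x : Q => γ t • x) ∘ (fun h : G => h • q) := by
      ext h; simp [mul_smul]
    have hmul : HasMFDerivAt 𝓘(ℝ, EG) 𝓘(ℝ, EG) (fun h : G => γ t * h) 1
        (mfderiv 𝓘(ℝ, EG) 𝓘(ℝ, EG) (fun h : G => γ t * h) 1) :=
      ((contMDiff_mul_left (I := 𝓘(ℝ, EG)) (n := ∞)).mdifferentiableAt (by simp)).hasMFDerivAt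
    have e1 : HasMFDerivAt 𝓘(ℝ, EG) 𝓘(ℝ, E) ((fun g : G => g • q) ∘ (fun h => γ t * h)) 1
        ((mfderiv 𝓘(ℝ, EG) 𝓘(ℝ, E) (fun g : G => g • q) (γ t) : EG →L[ℝ] E) ∘L
          (mfderiv 𝓘(ℝ, EG) 𝓘(ℝ, EG) (fun h : G => γ t * h) 1 : EG →L[ℝ] EG)) := by
      refine HasMFDerivAt.comp (1 : G) ?_ hmul
      rw [mul_one]
      exact ((contMDiff_smul_left EG E q).mdifferentiableAt (by simp)).hasMFDerivAt
    have e2 : HasMFDerivAt 𝓘(ℝ, EG) 𝓘(ℝ, E) ((fun x : Q => γ t • x) ∘ (fun h : G => h • q)) 1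
        ((mfderiv 𝓘(ℝ, E) 𝓘(ℝ, E) (fun x : Q => γ t • x) ((1 : G) • q) : E →L[ℝ] E) ∘L
          (mfderiv 𝓘(ℝ, EG) 𝓘(ℝ, E) (fun h : G => h • q) 1 : EG →L[ℝ] E)) :=
      ((contMDiff_smul_right EG E (γ t)).mdifferentiableAt (by simp)).hasMFDerivAt.comp (1 : G)
        ((contMDiff_smul_left EG E q).mdifferentiableAt (by simp)).hasMFDerivAt
    rw [hfun] at e1
    have e3 := DFunLike.congr_fun (hasMFDerivAt_unique e1 e2) ξ
    have hz : (mfderiv 𝓘(ℝ, EG) 𝓘(ℝ, E) (fun g : G => g • q) 1 : EG →L[ℝ] E) ξ = 0 := hξ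
    have e4 : (mfderiv 𝓘(ℝ, EG) 𝓘(ℝ, E) (fun g : G => g • q) (γ t) : EG →L[ℝ] E)
        ((mfderiv 𝓘(ℝ, EG) 𝓘(ℝ, EG) (fun h : G => γ t * h) 1 : EG →L[ℝ] EG) ξ) = 0 := by
      refine e3.trans ?_
      change (mfderiv 𝓘(ℝ, E) 𝓘(ℝ, E) (fun x : Q => γ t • x) ((1 : G) • q) : E →L[ℝ] E)
        ((mfderiv 𝓘(ℝ, EG) 𝓘(ℝ, E) (fun g : G => g • q) 1 : EG →L[ℝ] E) ξ) = 0
      rw [hz, map_zero]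
    apply ContinuousLinearMap.ext_ring
    change (mfderiv 𝓘(ℝ, EG) 𝓘(ℝ, E) (fun g : G => g • q) (γ t) : EG →L[ℝ] E)
      ((1 : ℝ) • (mfderiv 𝓘(ℝ, EG) 𝓘(ℝ, EG) (fun h : G => γ t * h) 1 : EG →L[ℝ] EG) ξ) =
        (1 : ℝ) • (0 : E)
    rw [one_smul, smul_zero, e4]
    rfl
  have hconst : IsMIntegralCurveAt (I := 𝓘(ℝ, E)) (fun _ : ℝ => q)
      (fun _ => (0 : TangentSpace 𝓘(ℝ, E) _)) 0 := by
    filter_upwards with t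
    refine (hasMFDerivAt_const q t).congr_mfderiv ?_
    apply ContinuousLinearMap.ext_ring
    change (0 : E) = (1 : ℝ) • (0 : E)
    simp
  have hzero : ContMDiff 𝓘(ℝ, E) 𝓘(ℝ, E).tangent 1
      (fun x : Q => (⟨x, 0⟩ : TangentBundle 𝓘(ℝ, E) Q)) :=
    contMDiff_zeroSection ℝ (fun x : Q => TangentSpace 𝓘(ℝ, E) x)
  have heq := isMIntegralCurveAt_eventuallyEq_of_contMDiffAt_boundaryless
    hzero.contMDiffAt horb hconst (by simp [h0])
  -- By uniqueness of integral curves of the zero field, γ(t)·q = q near 0. Freeness then gives γ =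
  -- 1 there, and its velocity ξ at 0 is zero.
  have hγ1 : (fun _ : ℝ => (1 : G)) =ᶠ[𝓝 0] γ := by
    filter_upwards [heq] with t ht using (hfree _ _ ht).symm
  have hd := (hγ.self_of_nhds).congr_of_eventuallyEq hγ1
  have h5 := DFunLike.congr_fun (hasMFDerivAt_unique hd (hasMFDerivAt_const (1 : G) (0 : ℝ)))
    (1 : ℝ)
  have h6 : (1 : ℝ) • (mfderiv 𝓘(ℝ, EG) 𝓘(ℝ, EG) (fun h : G => γ 0 * h) 1 : EG →L[ℝ] EG) ξ
    = (0 : EG) := h5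
  have h7 : (fun h : G => γ 0 * h) = id := by ext h; simp [h0]
  rw [h7, one_smul, mfderiv_id] at h6
  exact h6

end SmoothAction

/-! ### The quotient by G_W: induced action, generators and the kernel of Tρ -/

section Reduction

variable {E Q EG G E' Q' EF F : Type*}
  [NormedAddCommGroup E] [NormedSpace ℝ E]
  [TopologicalSpace Q] [ChartedSpace E Q] [IsManifold 𝓘(ℝ, E) ∞ Q]
  [NormedAddCommGroup EG] [NormedSpace ℝ EG]
  [TopologicalSpace G] [ChartedSpace EG G] [Group G] [LieGroup 𝓘(ℝ, EG) ∞ G]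
  [MulAction G Q]
  [NormedAddCommGroup E'] [NormedSpace ℝ E']
  [TopologicalSpace Q'] [ChartedSpace E' Q'] [IsManifold 𝓘(ℝ, E') ∞ Q']
  [NormedAddCommGroup EF] [NormedSpace ℝ EF]
  [TopologicalSpace F] [ChartedSpace EF F] [Group F] [LieGroup 𝓘(ℝ, EF) ∞ F]
  [MulAction F Q'] {GW : Subgroup G} {ρ : Q → Q'} {pr : G →* F}

namespace IsReduction

/-- The action on the orbit manifold is smooth. -/
theorem contMDiffSMul [ContMDiffSMul 𝓘(ℝ, EG) 𝓘(ℝ, E) ∞ G Q]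
    (h : IsReduction (EG := EG) (E := E) (EF := EF) (E' := E') GW ρ pr) :
    ContMDiffSMul 𝓘(ℝ, EF) 𝓘(ℝ, E') ∞ F Q' := by
  refine ⟨fun ⟨f, x⟩ => ?_⟩
  obtain ⟨g, rfl⟩ := h.surjective_group f
  obtain ⟨q, rfl⟩ := h.surjective_base x
  obtain ⟨s, hs, hs0, hs1⟩ := (h.isSubmersion_group.isSubmersionAt g).exists_section
  obtain ⟨σ, hσ, hσ0, hσ1⟩ := (h.isSubmersion_base.isSubmersionAt q).exists_section
  -- With local sections of both projections, the quotient action is locally (f, x) ↦ ρ(s(f)·σ(x)),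
  -- a composite of smooth maps.
  have hc : ContMDiffAt (𝓘(ℝ, EF).prod 𝓘(ℝ, E')) 𝓘(ℝ, E') ∞
      (fun p : F × Q' => ρ (s p.1 • σ p.2)) (pr g, ρ q) := by
    refine (h.isSubmersion_base.contMDiff _).comp (pr g, ρ q)
      (f := fun p : F × Q' => s p.1 • σ p.2) ?_
    exact (ContMDiffSMul.contMDiff_smul (I := 𝓘(ℝ, EG)) (I' := 𝓘(ℝ, E)) (n := ∞) (G := G)
      (M := Q) _).comp (pr g, ρ q) (f := fun p : F × Q' => (s p.1, σ p.2))
      ((hs.comp (pr g, ρ q) (f := Prod.fst) contMDiffAt_fst).prodMk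
        (hσ.comp (pr g, ρ q) (f := Prod.snd) contMDiffAt_snd))
  refine hc.congr_of_eventuallyEq ?_
  rw [nhds_prod_eq]
  filter_upwards [hs1.prod_mk hσ1] with p hp
  rw [h.equivariant, hp.1, hp.2]

/-- The action on the orbit manifold is free. -/
theorem free (h : IsReduction (EG := EG) (E := E) (EF := EF) (E' := E') GW ρ pr)
    (hfree : ∀ (g : G) (q : Q), g • q = q → g = 1) (f : F) (x : Q') (hx : f • x = x) : f = 1 := by
  obtain ⟨g, rfl⟩ := h.surjective_group f
  obtain ⟨q, rfl⟩ := h.surjective_base x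
  rw [← h.equivariant, h.base_eq_iff] at hx
  obtain ⟨w, hw⟩ := hx
  have hw' : (w : G) • q = g • q := hw
  have h1 : ((w : G)⁻¹ * g) • q = q := by
    rw [mul_smul, ← hw', inv_smul_smul]
  have h2 : g = w := (inv_mul_eq_one.1 (hfree _ _ h1)).symm
  have h3 : g ∈ pr.ker := by rw [h.ker_eq, h2]; exact w.2
  exact h3

/-- Differentiate ρ(g·q) = pr(g)·ρ(q) in g at 1. Differentiating the same identity in q gives
`mfderiv_smul`. -/
theorem mfderiv_generator [ContMDiffSMul 𝓘(ℝ, EG) 𝓘(ℝ, E) ∞ G Q]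
    (h : IsReduction (EG := EG) (E := E) (EF := EF) (E' := E') GW ρ pr)
    (q : Q) (ξ : GroupLieAlgebra 𝓘(ℝ, EG) G) :
    mfderiv 𝓘(ℝ, E) 𝓘(ℝ, E') ρ q (generator q ξ) =
      generator (EG := EF) (E := E') (ρ q) (lieProjection pr ξ) := by
  have := h.contMDiffSMul
  have hρ : HasMFDerivAt 𝓘(ℝ, E) 𝓘(ℝ, E') ρ ((1 : G) • q)
      (mfderiv 𝓘(ℝ, E) 𝓘(ℝ, E') ρ q : E →L[ℝ] E') := by
    rw [one_smul]
    exact (h.isSubmersion_base.contMDiff.mdifferentiableAt (by simp)).hasMFDerivAt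
  have hF : HasMFDerivAt 𝓘(ℝ, EF) 𝓘(ℝ, E') (fun f : F => f • ρ q) (pr 1)
      (mfderiv 𝓘(ℝ, EF) 𝓘(ℝ, E') (fun f : F => f • ρ q) 1 : EF →L[ℝ] E') := by
    rw [map_one]
    exact ((contMDiff_smul_left EF E' (ρ q)).mdifferentiableAt (by simp)).hasMFDerivAt
  have h1 := hρ.comp (1 : G)
    ((contMDiff_smul_left EG E q).mdifferentiableAt (x := (1 : G)) (by simp)).hasMFDerivAt
  have h2 := hF.comp (1 : G)
    (h.isSubmersion_group.contMDiff.mdifferentiableAt (x := (1 : G)) (by simp)).hasMFDerivAt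
  have hfun : (ρ ∘ fun g : G => g • q) = (fun f : F => f • ρ q) ∘ pr := by
    ext g; exact h.equivariant g q
  rw [hfun] at h1
  exact DFunLike.congr_fun (hasMFDerivAt_unique h1 h2) ξ

theorem mfderiv_smul [ContMDiffSMul 𝓘(ℝ, EG) 𝓘(ℝ, E) ∞ G Q]
    (h : IsReduction (EG := EG) (E := E) (EF := EF) (E' := E') GW ρ pr)
    (g : G) (q : Q) (v : TangentSpace 𝓘(ℝ, E) q) :
    (mfderiv 𝓘(ℝ, E) 𝓘(ℝ, E') ρ (g • q)
      (mfderiv 𝓘(ℝ, E) 𝓘(ℝ, E) (fun x : Q => g • x) q v) : E') =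
      mfderiv 𝓘(ℝ, E') 𝓘(ℝ, E') (fun x : Q' => pr g • x) (ρ q)
        (mfderiv 𝓘(ℝ, E) 𝓘(ℝ, E') ρ q v) := by
  have := h.contMDiffSMul
  have h1 := (h.isSubmersion_base.contMDiff.mdifferentiableAt (x := g • q)
    (by simp)).hasMFDerivAt.comp q
    ((contMDiff_smul_right EG E g).mdifferentiableAt (x := q) (by simp)).hasMFDerivAt
  have h2 := ((contMDiff_smul_right EF E' (pr g)).mdifferentiableAt (x := ρ q)
    (by simp)).hasMFDerivAt.comp q
    (h.isSubmersion_base.contMDiff.mdifferentiableAt (x := q) (by simp)).hasMFDerivAt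
  have hfun : (ρ ∘ fun x : Q => g • x) = (fun x : Q' => pr g • x) ∘ ρ := by
    ext x; exact h.equivariant g x
  rw [hfun] at h1
  exact DFunLike.congr_fun (hasMFDerivAt_unique h1 h2) v

/-- The vectors tangent to the orbits of `G_W` are the kernel of `Tρ`. -/
theorem mem_tangentVectors_orbit_iff
    (h : IsReduction (EG := EG) (E := E) (EF := EF) (E' := E') GW ρ pr)
    (q : Q) (v : TangentSpace 𝓘(ℝ, E) q) :
    v ∈ tangentVectors 𝓘(ℝ, E) (MulAction.orbit GW q) q ↔
      mfderiv 𝓘(ℝ, E) 𝓘(ℝ, E') ρ q v = 0 := by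
  constructor
  · intro hv
    have h1 := mfderiv_eq_of_mem_tangentVectors hv (J := 𝓘(ℝ, E')) (f := ρ) (g := fun _ => ρ q)
      (h.isSubmersion_base.contMDiff.mdifferentiableAt (by simp)) mdifferentiableAt_const
      (fun y hy => (h.base_eq_iff _ _).2 hy)
    rw [mfderiv_const] at h1
    exact h1
  · intro hv
    have h1 := (h.isSubmersion_base.isSubmersionAt q).mem_tangentVectors_fiber hv
    have h2 : ρ ⁻¹' {ρ q} = MulAction.orbit GW q := by
      ext y; exact h.base_eq_iff y q
    rwa [h2] at h1

/-- The derivative of the projection of Lie groups is onto. -/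
theorem lieProjection_surjective
    (h : IsReduction (EG := EG) (E := E) (EF := EF) (E' := E') GW ρ pr) :
    Function.Surjective (lieProjection (EG := EG) (EF := EF) pr) := by
  intro ν
  obtain ⟨s, hs, hs0, hs1⟩ := (h.isSubmersion_group.isSubmersionAt (1 : G)).exists_section
  rw [map_one] at hs hs0 hs1
  have hpr : HasMFDerivAt 𝓘(ℝ, EG) 𝓘(ℝ, EF) pr (s 1)
      (mfderiv 𝓘(ℝ, EG) 𝓘(ℝ, EF) pr 1 : EG →L[ℝ] EF) := by
    rw [hs0]
    exact (h.isSubmersion_group.contMDiff.mdifferentiableAt (by simp)).hasMFDerivAt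
  have h1 := hpr.comp (1 : F) (hs.mdifferentiableAt (by simp)).hasMFDerivAt
  have h2 : HasMFDerivAt 𝓘(ℝ, EF) 𝓘(ℝ, EF) (pr ∘ s) 1 (ContinuousLinearMap.id ℝ EF) :=
    (hasMFDerivAt_id (1 : F)).congr_of_eventuallyEq hs1
  exact ⟨(mfderiv 𝓘(ℝ, EF) 𝓘(ℝ, EG) s 1 : EF →L[ℝ] EG) ν,
    DFunLike.congr_fun (hasMFDerivAt_unique h1 h2) ν⟩

end IsReduction

end Reduction

/-! ### Cotangent lifts, the momentum map, and pairings with vector fields -/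

section CotangentLift

variable {EG G E Q : Type*}
  [NormedAddCommGroup EG] [NormedSpace ℝ EG] [TopologicalSpace G] [ChartedSpace EG G] [Group G]
  [LieGroup 𝓘(ℝ, EG) ∞ G]
  [NormedAddCommGroup E] [NormedSpace ℝ E] [TopologicalSpace Q] [ChartedSpace E Q]
  [IsManifold 𝓘(ℝ, E) ∞ Q] [MulAction G Q]

theorem cotangentLift_one [ContMDiffSMul 𝓘(ℝ, EG) 𝓘(ℝ, E) ∞ G Q] (α : CotangentBundle E Q) :
    cotangentLift (1 : G) α = α := by
  obtain ⟨x, p⟩ := α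
  have h1 : (fun y : Q => (1 : G) • y) = id := by ext y; simp
  have h2 : ((mfderiv 𝓘(ℝ, E) 𝓘(ℝ, E) (fun y : Q => (1 : G) • y) x).inverse : E →L[ℝ] E) =
      ContinuousLinearMap.id ℝ E := by
    rw [mfderiv_smul_inverse EG (1 : G) x, inv_one, h1]
    exact mfderiv_id
  have h3 : (p : E →L[ℝ] ℝ) ∘L ((mfderiv 𝓘(ℝ, E) 𝓘(ℝ, E) (fun y : Q => (1 : G) • y) x).inverse :
    E →L[ℝ] E) = p := by rw [h2]; rfl
  -- The base points `1 • x` and `x` agree only propositionally, so the equality is proved for a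
  -- free base point and covector in the model space.
  have key : ∀ (x' : Q) (p' : E →L[ℝ] ℝ), x' = x → p' = p →
      (⟨x', p'⟩ : CotangentBundle E Q) = ⟨x, p⟩ := by
    rintro _ _ rfl rfl; rfl
  exact key _ _ (one_smul G x) h3

/-- The cotangent lift of a smooth action is smooth in the group variable. -/
theorem contMDiffAt_cotangentLift [ContMDiffSMul 𝓘(ℝ, EG) 𝓘(ℝ, E) ∞ G Q]
    (α : CotangentBundle E Q) :
    ContMDiffAt 𝓘(ℝ, EG) (cotangentModel E) ∞ (fun g : G => cotangentLift g α) 1 := by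
  rw [contMDiffAt_hom_bundle]
  refine ⟨(contMDiff_smul_left EG E α.proj).contMDiffAt, ?_⟩
  -- Smoothness of the inverted derivative comes for free once it is read as the derivative of y ↦
  -- g⁻¹·y at the moving point g·τ(α), since g⁻¹·y is jointly smooth.
  have hf : ContMDiffAt (𝓘(ℝ, EG).prod 𝓘(ℝ, E)) 𝓘(ℝ, E) ∞
      (Function.uncurry fun (g : G) (y : Q) => g⁻¹ • y) (1, (1 : G) • α.proj) :=
    (ContMDiffSMul.contMDiff_smul (I := 𝓘(ℝ, EG)) (I' := 𝓘(ℝ, E)) (n := ∞) (G := G) (M := Q)).comp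
      ((contMDiff_fst.inv).prodMk contMDiff_snd) _
  have h1 := ContMDiffAt.mfderiv (m := ∞) (fun (g : G) (y : Q) => g⁻¹ • y)
    (fun g : G => g • α.proj) hf ((contMDiff_smul_left EG E α.proj).contMDiffAt) (by simp)
  let e := trivializationAt E (fun x : Q => TangentSpace 𝓘(ℝ, E) x)
    ((1 : G)⁻¹ • (1 : G) • α.proj)
  have hmem : α.proj ∈ e.baseSet := by
    simp [e]
  let L : E →L[ℝ] ℝ := α.2 ∘L e.symmL ℝ α.proj
  have hL : ∀ (y : Q) (v : E), y = α.proj → L (e.continuousLinearMapAt ℝ y v) = α.2 v := by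
    rintro y v rfl
    exact congrArg α.2 (e.symmL_continuousLinearMapAt hmem v)
  have h2 := (contMDiffAt_const (c := L)).clm_comp h1
  refine h2.congr_of_eventuallyEq (Filter.Eventually.of_forall fun g => ?_)
  ext v
  simp only [inTangentCoordinates, ContinuousLinearMap.inCoordinates,
    ContinuousLinearMap.comp_apply]
  refine Eq.trans ?_ (hL _ _ (inv_smul_smul g α.proj)).symm
  have ht : ∀ (b y : Q) (r : ℝ),
      (trivializationAt ℝ (Trivial Q ℝ) b).continuousLinearMapAt ℝ y r = r := by
    intro b y r; simp
  refine (ht _ _ _).trans ?_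
  simp only [cotangentLift]
  rw [mfderiv_smul_inverse EG g α.proj]
  rfl

variable (E Q) in
theorem contMDiff_cotangentProj :
    ContMDiff (cotangentModel E) 𝓘(ℝ, E) ∞ (fun β : CotangentBundle E Q => β.proj) := 
  contMDiff_proj _

/-- The canonical momentum map is `⟨J(α), ξ⟩ = α(ξ_Q)`. -/
theorem momentumMap_apply [ContMDiffSMul 𝓘(ℝ, EG) 𝓘(ℝ, E) ∞ G Q]
    (α : CotangentBundle E Q) (ξ : GroupLieAlgebra 𝓘(ℝ, EG) G) :
    momentumMap α ξ = α.2 (generator α.proj ξ) := by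
  have h1 : HasMFDerivAt (cotangentModel E) 𝓘(ℝ, E) (fun β : CotangentBundle E Q => β.proj)
      (cotangentLift (1 : G) α) (cotangentProjDeriv α : E × (E →L[ℝ] ℝ) →L[ℝ] E) := by
    rw [cotangentLift_one (EG := EG)]
    exact ((contMDiff_cotangentProj E Q).mdifferentiableAt (by simp)).hasMFDerivAt
  -- The lifted orbit of α projects to the orbit of its base point, so Tτ sends the lifted generator
  -- to ξ_Q; Θ then evaluates α on it.
  have h2 := h1.comp (1 : G)
    ((contMDiffAt_cotangentLift (EG := EG) (G := G) α).mdifferentiableAt (by simp)).hasMFDerivAt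
  have h3 : HasMFDerivAt 𝓘(ℝ, EG) 𝓘(ℝ, E) (fun g : G => g • α.proj) 1 _ :=
    ((contMDiff_smul_left EG E α.proj).mdifferentiableAt (by simp)).hasMFDerivAt
  have h4 := DFunLike.congr_fun (hasMFDerivAt_unique h2 h3) ξ
  exact congrArg (α.2 : E →L[ℝ] ℝ) h4

/-- The pairing of covectors with a smooth vector field is smooth. -/
theorem contMDiff_pairing {Y : ∀ x : Q, TangentSpace 𝓘(ℝ, E) x}
    (hY : ContMDiff 𝓘(ℝ, E) 𝓘(ℝ, E).tangent ∞ (fun x => (⟨x, Y x⟩ : TangentBundle 𝓘(ℝ, E) Q))) :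
    ContMDiff (cotangentModel E) 𝓘(ℝ, ℝ) ∞
      (fun α : CotangentBundle E Q => (α.2 (Y α.proj) : ℝ)) := by
  have h1 := ContMDiff.clm_bundle_apply (n := ∞) (IM := cotangentModel E)
    (IB := 𝓘(ℝ, E)) (F₁ := E) (F₂ := ℝ)
    (E₁ := fun x : Q => TangentSpace 𝓘(ℝ, E) x) (E₂ := Trivial Q ℝ)
    (b := fun α : CotangentBundle E Q => α.proj) (ϕ := fun α => α.2)
    (v := fun α => Y α.proj) contMDiff_id (hY.comp (contMDiff_cotangentProj E Q))
  intro α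
  have h2 := (contMDiffAt_totalSpace.1 (h1 α)).2
  exact h2

/-- Straight lines in the fibres of the cotangent bundle are smooth. -/
theorem contMDiff_fiberLine (α : CotangentBundle E Q)
    (β : TangentSpace 𝓘(ℝ, E) α.proj →L[ℝ] Trivial Q ℝ α.proj) :
    ContMDiff 𝓘(ℝ, ℝ) (cotangentModel E) ∞
      (fun t : ℝ => (⟨α.proj, α.2 + t • β⟩ : CotangentBundle E Q)) := by
  intro t
  rw [contMDiffAt_hom_bundle]
  refine ⟨contMDiffAt_const, ?_⟩
  let A : (E →L[ℝ] ℝ) → (E →L[ℝ] ℝ) := fun p => ContinuousLinearMap.inCoordinates E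
    (fun x : Q => TangentSpace 𝓘(ℝ, E) x) ℝ (Trivial Q ℝ) α.proj α.proj α.proj α.proj p
  have h1 : ContDiff ℝ ∞ (fun t : ℝ => A α.2 + t • A β) := by fun_prop
  refine h1.contMDiff.contMDiffAt.congr_of_eventuallyEq (Filter.Eventually.of_forall fun s => ?_)
  ext v
  simp [A, ContinuousLinearMap.inCoordinates]

/-- The derivative of the pairing with a vector field `Y` in the direction of a fibre. -/
theorem exists_forall_mfderiv_pairing (α : CotangentBundle E Q)
    (β : TangentSpace 𝓘(ℝ, E) α.proj →L[ℝ] Trivial Q ℝ α.proj) :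
    ∃ w : TangentSpace (cotangentModel E) α, ∀ Y : ∀ x : Q, TangentSpace 𝓘(ℝ, E) x,
      ContMDiff 𝓘(ℝ, E) 𝓘(ℝ, E).tangent ∞ (fun x => (⟨x, Y x⟩ : TangentBundle 𝓘(ℝ, E) Q)) →
      mfderiv (cotangentModel E) 𝓘(ℝ, ℝ) (fun γ : CotangentBundle E Q => (γ.2 (Y γ.proj) : ℝ)) α w
        = β (Y α.proj) := by
  -- The witness is the vertical vector of this line. Along it every pairing is affine in t with
  -- slope β(Y), so one `w` serves all `Y` at once.
  let γ : ℝ → CotangentBundle E Q := fun t => ⟨α.proj, α.2 + t • β⟩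
  have hγ0 : γ 0 = α := by simp [γ]
  refine ⟨(mfderiv 𝓘(ℝ, ℝ) (cotangentModel E) γ 0 : ℝ →L[ℝ] E × (E →L[ℝ] ℝ)) 1, fun Y hY => ?_⟩
  have h1 : HasMFDerivAt (cotangentModel E) 𝓘(ℝ, ℝ)
      (fun γ : CotangentBundle E Q => (γ.2 (Y γ.proj) : ℝ)) (γ 0)
      (mfderiv (cotangentModel E) 𝓘(ℝ, ℝ) (fun γ : CotangentBundle E Q => (γ.2 (Y γ.proj) : ℝ)) α :
        E × (E →L[ℝ] ℝ) →L[ℝ] ℝ) := by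
    rw [hγ0]
    exact ((contMDiff_pairing hY).mdifferentiableAt (by simp)).hasMFDerivAt
  have h2 := h1.comp (0 : ℝ)
    ((contMDiff_fiberLine α β).mdifferentiableAt (x := 0) (by simp)).hasMFDerivAt
  have h3 : HasFDerivAt (fun t : ℝ => (α.2 (Y α.proj) : ℝ) + t • (β (Y α.proj) : ℝ))
      ((ContinuousLinearMap.id ℝ ℝ).smulRight (β (Y α.proj) : ℝ)) 0 :=
    (((ContinuousLinearMap.id ℝ ℝ).smulRight (β (Y α.proj) : ℝ)).hasFDerivAt).const_add _
  have h4 := DFunLike.congr_fun (hasMFDerivAt_unique h2 h3.hasMFDerivAt) (1 : ℝ)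
  refine h4.trans ?_
  exact one_smul ℝ (β (Y α.proj) : ℝ)

/-- The pairing with a vector field vanishing at `q` has a critical point at the zero covector
over `q`. -/
theorem mfderiv_pairing_eq_zero {Y : ∀ x : Q, TangentSpace 𝓘(ℝ, E) x}
    (hY : ContMDiff 𝓘(ℝ, E) 𝓘(ℝ, E).tangent ∞ (fun x => (⟨x, Y x⟩ : TangentBundle 𝓘(ℝ, E) Q)))
    {q : Q} (hq : Y q = 0) :
    mfderiv (cotangentModel E) 𝓘(ℝ, ℝ) (fun γ : CotangentBundle E Q => (γ.2 (Y γ.proj) : ℝ))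
      (⟨q, 0⟩ : CotangentBundle E Q) = 0 := by
  set α : CotangentBundle E Q := ⟨q, 0⟩ with hα
  let T := fun x : Q => TangentSpace 𝓘(ℝ, E) x
  let e := trivializationAt E T q
  have h1 := ((contMDiffAt_hom_bundle (n := ∞) (IM := cotangentModel E) (IB := 𝓘(ℝ, E))
    (id : CotangentBundle E Q → CotangentBundle E Q) (x₀ := α)).1 contMDiffAt_id).2
  have h2 := (contMDiffAt_totalSpace.1
    ((hY.comp (contMDiff_cotangentProj E Q)).contMDiffAt (x := α))).2
  -- In a trivialization the pairing is the evaluation map z ↦ z.1 z.2 after `Ψ`. Both components of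
  -- `Ψ α` vanish, and a bilinear map has zero derivative at the origin.
  let Ψ : CotangentBundle E Q → (E →L[ℝ] ℝ) × E := fun x =>
    (ContinuousLinearMap.inCoordinates E T ℝ (Trivial Q ℝ) q x.proj q x.proj x.2,
      (e ⟨x.proj, Y x.proj⟩).2)
  have h3 : ContMDiffAt (cotangentModel E) 𝓘(ℝ, (E →L[ℝ] ℝ) × E) ∞ Ψ α := h1.prodMk_space h2
  have hq1 : q ∈ e.baseSet := FiberBundle.mem_baseSet_trivializationAt' q
  have he : ∀ x ∈ e.baseSet, ∀ v : T x, (e ⟨x, v⟩).2 = e.continuousLinearMapAt ℝ x v := by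
    intro x hx v
    exact (congrFun (e.coe_linearMapAt_of_mem (R := ℝ) hx) v).symm
  have hΨ0 : Ψ α = 0 := by
    refine Prod.ext ?_ ?_
    · ext v
      simp only [Ψ, ContinuousLinearMap.inCoordinates]
      exact map_zero ((trivializationAt ℝ (Trivial Q ℝ) q).continuousLinearMapAt ℝ q)
    · change (e ⟨q, Y q⟩).2 = 0
      rw [he q hq1, hq]
      exact map_zero _
  have hb : HasFDerivAt (fun z : (E →L[ℝ] ℝ) × E => z.1 z.2) (0 : (E →L[ℝ] ℝ) × E →L[ℝ] ℝ) 0 :=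
    ((isBoundedBilinearMap_apply (𝕜 := ℝ) (E := E) (F := ℝ)).hasFDerivAt 0).congr_fderiv
      (by ext <;> simp)
  have h4 : HasMFDerivAt (cotangentModel E) 𝓘(ℝ, ℝ) ((fun z : (E →L[ℝ] ℝ) × E => z.1 z.2) ∘ Ψ) α
      _ := HasMFDerivAt.comp α (by rw [hΨ0]; exact hb.hasMFDerivAt)
        (h3.mdifferentiableAt (by simp)).hasMFDerivAt
  have h5 : (fun γ : CotangentBundle E Q => (γ.2 (Y γ.proj) : ℝ)) =ᶠ[𝓝 α]
      (fun z : (E →L[ℝ] ℝ) × E => z.1 z.2) ∘ Ψ := by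
    have : ∀ᶠ γ : CotangentBundle E Q in 𝓝 α, γ.proj ∈ e.baseSet :=
      (contMDiff_cotangentProj E Q).continuous.continuousAt (e.open_baseSet.mem_nhds hq1)
    filter_upwards [this] with γ hγ
    have ht : ∀ (b y : Q) (r : ℝ),
        (trivializationAt ℝ (Trivial Q ℝ) b).continuousLinearMapAt ℝ y r = r := by
      intro b y r; simp
    refine Eq.symm ((ht _ _ _).trans ?_)
    refine congrArg γ.2 ?_
    change e.symmL ℝ γ.proj (e ⟨γ.proj, Y γ.proj⟩).2 = Y γ.proj
    rw [he _ hγ]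
    exact e.symmL_continuousLinearMapAt hγ _
  have h6 := (h4.congr_of_eventuallyEq h5).mfderiv
  rw [h6]
  ext w
  rfl

/-- The generators of a smooth action, applied to a smooth function, form a smooth vector field. -/
theorem contMDiffAt_generator [ContMDiffSMul 𝓘(ℝ, EG) 𝓘(ℝ, E) ∞ G Q]
    {ξ : Q → GroupLieAlgebra 𝓘(ℝ, EG) G} {q : Q}
    (hξ : ContMDiffAt (M' := EG) 𝓘(ℝ, E) 𝓘(ℝ, EG) ∞ ξ q) :
    ContMDiffAt 𝓘(ℝ, E) 𝓘(ℝ, E).tangent ∞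
      (fun x => (⟨x, generator x (ξ x)⟩ : TangentBundle 𝓘(ℝ, E) Q)) q := by
  have hf : ContMDiffAt (𝓘(ℝ, E).prod 𝓘(ℝ, EG)) 𝓘(ℝ, E) ∞
      (Function.uncurry fun (y : Q) (g : G) => g • y) (q, 1) :=
    (ContMDiffSMul.contMDiff_smul (I := 𝓘(ℝ, EG)) (I' := 𝓘(ℝ, E)) (n := ∞) (G := G) (M := Q)).comp
      (contMDiff_snd.prodMk contMDiff_fst) _
  -- The generator at y is a derivative in g at 1 with y as a parameter.
  have h1 := ContMDiffAt.mfderiv (m := ∞) (fun (y : Q) (g : G) => g • y)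
    (fun _ : Q => (1 : G)) hf contMDiffAt_const (by simp)
  have hv : ContMDiffAt 𝓘(ℝ, E) 𝓘(ℝ, EG).tangent ∞
      (fun x : Q => (⟨1, ξ x⟩ : TangentBundle 𝓘(ℝ, EG) G)) q := by
    rw [contMDiffAt_totalSpace]
    refine ⟨contMDiffAt_const, ?_⟩
    let e := trivializationAt EG (fun g : G => TangentSpace 𝓘(ℝ, EG) g) 1
    let A : EG →L[ℝ] EG := e.continuousLinearMapAt ℝ 1
    have h3 : ContMDiffAt 𝓘(ℝ, E) 𝓘(ℝ, EG) ∞ (A ∘ ξ) q :=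
      ContMDiffAt.comp (I' := 𝓘(ℝ, EG)) (M' := EG) q A.contDiff.contMDiff.contMDiffAt hξ
    refine h3.congr_of_eventuallyEq (Filter.Eventually.of_forall fun x => ?_)
    have : (1 : G) ∈ e.baseSet := FiberBundle.mem_baseSet_trivializationAt' 1
    exact (congrFun (e.coe_linearMapAt_of_mem (R := ℝ) this) (ξ x)).symm
  have h2 := ContMDiffAt.clm_apply_of_inCoordinates (b₁ := fun _ : Q => (1 : G))
    (b₂ := fun y : Q => (1 : G) • y) (v := ξ) h1 hv (contMDiff_smul_right EG E (1 : G)).contMDiffAt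
  have key : ∀ (x x' : Q) (v : E), x' = x →
      (⟨x', v⟩ : TangentBundle 𝓘(ℝ, E) Q) = ⟨x, v⟩ := by
    rintro _ _ _ rfl; rfl
  exact h2.congr_of_eventuallyEq (Filter.Eventually.of_forall fun x =>
    (key x _ _ (one_smul G x)).symm)

end CotangentLift

/-! ### Straightening a submersion to a linear map -/

section FlatChart

variable {E H M V : Type*} [NormedAddCommGroup E] [NormedSpace ℝ E] [FiniteDimensional ℝ E]
  [NormedAddCommGroup V] [NormedSpace ℝ V] [FiniteDimensional ℝ V]

/-- A smooth map with surjective derivative at a point is linear in suitable local coordinates,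
whose image may be taken convex. -/
theorem ContDiffOn.exists_straightening {f : E → V} {U : Set E} {z : E} (hU : IsOpen U)
    (hz : z ∈ U) (hf : ContDiffOn ℝ ∞ f U) (hs : Function.Surjective (fderiv ℝ f z)) :
    ∃ Ψ : OpenPartialHomeomorph E E, z ∈ Ψ.source ∧ Ψ.source ⊆ U ∧
      ContDiffOn ℝ ∞ Ψ Ψ.source ∧ ContDiffOn ℝ ∞ Ψ.symm Ψ.target ∧ Convex ℝ Ψ.target ∧
      ∀ y, fderiv ℝ f z (Ψ y) = f y := by
  set p := fderiv ℝ f z with hp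
  obtain ⟨s, hs⟩ : ∃ s : V →L[ℝ] E, ∀ v, p (s v) = v := by
    obtain ⟨s, hs⟩ := p.toLinearMap.exists_rightInverse_of_surjective
      (LinearMap.range_eq_top.2 hs)
    exact ⟨LinearMap.toContinuousLinearMap s, fun v => LinearMap.congr_fun hs v⟩
  -- `Φ` replaces the p-component of y by f(y): since p ∘ s = id, p(Φ y) = f y for every y, and the
  -- derivative of `Φ` at `z` is the identity.
  let Φ : E → E := fun y => y - s (p y) + s (f y)
  have hΦ : ∀ y ∈ U, ContDiffAt ℝ ∞ Φ y := by
    intro y hy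
    have := hf.contDiffAt (hU.mem_nhds hy)
    fun_prop
  have hfz : HasFDerivAt f p z :=
    ((hf.contDiffAt (hU.mem_nhds hz)).differentiableAt (by simp)).hasFDerivAt
  have hΦz : HasFDerivAt Φ ((ContinuousLinearEquiv.refl ℝ E : E ≃L[ℝ] E) : E →L[ℝ] E) z := by
    have h1 := ((hasFDerivAt_id z).sub (s.hasFDerivAt.comp z p.hasFDerivAt)).add
      (s.hasFDerivAt.comp z hfz)
    refine h1.congr_fderiv ?_
    ext v
    simp
  have ne : (∞ : WithTop ℕ∞) ≠ 0 := by simp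
  let Θ := (hΦ z hz).toOpenPartialHomeomorph Φ hΦz ne
  have hzΘ : z ∈ Θ.source := (hΦ z hz).mem_toOpenPartialHomeomorph_source hΦz ne
  -- the set on which the derivative is invertible
  let R : Set (E →L[ℝ] E) := Set.range ((↑) : (E ≃L[ℝ] E) → (E →L[ℝ] E))
  have hR : IsOpen R := ContinuousLinearEquiv.isOpen
  have hcont : ContinuousOn (fderiv ℝ Φ) U :=
    ContDiffOn.continuousOn_fderiv_of_isOpen (n := ∞)
      (fun y hy => (hΦ y hy).contDiffWithinAt) hU (by simp)
  have hU' : IsOpen (U ∩ fderiv ℝ Φ ⁻¹' R) := hcont.isOpen_inter_preimage hU hR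
  let O := Θ.target ∩ Θ.symm ⁻¹' (U ∩ fderiv ℝ Φ ⁻¹' R)
  have hO : IsOpen O := Θ.symm.isOpen_inter_preimage hU'
  have hzO : Θ z ∈ O := by
    refine ⟨Θ.map_source hzΘ, ?_⟩
    rw [Set.mem_preimage, Θ.left_inv hzΘ]
    exact ⟨hz, by rw [Set.mem_preimage, hΦz.fderiv]; exact ⟨_, rfl⟩⟩
  obtain ⟨ε, hε, hball⟩ := Metric.isOpen_iff.1 hO _ hzO
  -- Restricting on the target side makes the image a ball, hence convex; the ball is small enough
  -- that the derivative of `Φ` is invertible throughout, so the inverse is smooth on all of it.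
  let Ψ := (Θ.symm.restrOpen (Metric.ball (Θ z) ε) Metric.isOpen_ball).symm
  have htgt : Ψ.target = Metric.ball (Θ z) ε := by
    change Θ.target ∩ Metric.ball (Θ z) ε = _
    exact Set.inter_eq_right.2 fun y hy => (hball hy).1
  have hsrc : ∀ y ∈ Ψ.source, y ∈ Θ.source ∧ Θ y ∈ Metric.ball (Θ z) ε := by
    intro y hy
    have h1 : Ψ y ∈ Metric.ball (Θ z) ε := htgt ▸ Ψ.map_source hy
    have h2 : Ψ.symm (Ψ y) = y := Ψ.left_inv hy
    refine ⟨?_, h1⟩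
    rw [← h2]
    exact Θ.map_target (hball h1).1
  have hsrcU : ∀ y ∈ Ψ.source, y ∈ U ∩ fderiv ℝ Φ ⁻¹' R := by
    intro y hy
    obtain ⟨h1, h2⟩ := hsrc y hy
    have h3 := (hball h2).2
    rwa [Set.mem_preimage, Θ.left_inv h1] at h3
  refine ⟨Ψ, ?_, fun y hy => (hsrcU y hy).1, ?_, ?_, ?_, ?_⟩
  · have h1 := Ψ.map_target (x := Θ z) (by rw [htgt]; exact Metric.mem_ball_self hε)
    have h2 : Ψ.symm (Θ z) = z := Θ.left_inv hzΘ
    rwa [h2] at h1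
  · intro y hy
    exact (hΦ y (hsrcU y hy).1).contDiffWithinAt
  · intro y hy
    have hy' : y ∈ Metric.ball (Θ z) ε := htgt ▸ hy
    obtain ⟨h1, h2, A, hA⟩ := hball hy'
    refine ContDiffAt.contDiffWithinAt (f := Θ.symm) ?_
    refine Θ.contDiffAt_symm (f₀' := A) h1 ?_ (hΦ _ h2)
    rw [hA]
    exact ((hΦ _ h2).differentiableAt ne).hasFDerivAt
  · rw [htgt]; exact convex_ball _ _
  · intro y
    change p (y - s (p y) + s (f y)) = f y
    simp [hs]

variable [TopologicalSpace H] {I : ModelWithCorners ℝ E H} [I.Boundaryless]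
  [TopologicalSpace M] [ChartedSpace H M] [IsManifold I ∞ M]

/-- A submersion at a point is linear in a suitable chart with convex image. -/
theorem ContMDiff.exists_flat_chart {f : M → V} (hf : ContMDiff I 𝓘(ℝ, V) ∞ f) (x : M)
    (hs : Function.Surjective (mfderiv I 𝓘(ℝ, V) f x)) :
    ∃ φ ∈ IsManifold.maximalAtlas I ∞ M, x ∈ φ.source ∧ Convex ℝ (φ.extend I).target ∧
      ∃ p : E →L[ℝ] V, Function.Surjective p ∧ ∀ y ∈ φ.source, p (φ.extend I y) = f y := by
  let c := chartAt H x
  let h := I.toHomeomorph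
  let U : Set E := h.symm ⁻¹' c.target
  have hU : IsOpen U := c.open_target.preimage h.symm.continuous
  let F : E → V := fun z => f (c.symm (h.symm z))
  have hF : ContDiffOn ℝ ∞ F U := by
    rw [← contMDiffOn_iff_contDiffOn]
    refine hf.comp_contMDiffOn ?_
    have := contMDiffOn_extChartAt_symm (I := I) (n := ∞) x
    refine this.mono fun z hz => ?_
    simpa [extChartAt, U, c, h, I.range_eq_univ] using hz
  have hx : x ∈ c.source := mem_chart_source H x
  have hxU : h (c x) ∈ U := by simp [U, c, h]
  have hFz : Function.Surjective (fderiv ℝ F (h (c x))) := by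
    have : mfderiv I 𝓘(ℝ, V) f x = fderiv ℝ F (h (c x)) := by
      rw [((hf x).mdifferentiableAt (by simp)).mfderiv, I.range_eq_univ, fderivWithin_univ]
      rfl
    rw [← this]; exact hs
  obtain ⟨Ψ, hΨx, hΨU, hΨ, hΨ', hconv, hp⟩ := hF.exists_straightening hU hxU hFz
  let φ : OpenPartialHomeomorph M H :=
    ((c.trans h.toOpenPartialHomeomorph).trans Ψ).trans h.symm.toOpenPartialHomeomorph
  have hφs : φ.source = c.source ∩ (fun y => h (c y)) ⁻¹' Ψ.source := by
    ext y; simp [φ]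
  have hφt : (φ.extend I).target = Ψ.target := by
    ext z
    have h1 : z ∈ (φ.extend I).target ↔ z ∈ Ψ.target ∧ Ψ.symm z ∈ U := by
      simp [φ, U, h, I.range_eq_univ]
    rw [h1, and_iff_left_iff_imp]
    exact fun hz => hΨU (Ψ.map_target hz)
  refine ⟨φ, ?_, ?_, ?_, fderiv ℝ F (h (c x)), hFz, ?_⟩
  · refine φ.mem_maximalAtlas_of_contMDiffOn ?_ ?_
    · have h1 : ContMDiffOn I 𝓘(ℝ, E) ∞ (extChartAt I x) φ.source :=
        contMDiffOn_extChartAt.mono (by rw [hφs]; exact Set.inter_subset_left)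
      have h2 := (contMDiffOn_iff_contDiffOn.2 hΨ).comp h1
        (fun y hy => by rw [hφs] at hy; exact hy.2)
      exact I.contMDiffOn_symm.comp h2 (fun y _ => by simp [I.range_eq_univ])
    · have h1 : ∀ z ∈ φ.target, h z ∈ Ψ.target := fun z hz => by
        rw [← hφt]; simpa [h] using hz
      have h2 := (contMDiffOn_iff_contDiffOn.2 hΨ').comp (I.contMDiff (n := ∞)).contMDiffOn h1
      refine (contMDiffOn_extChartAt_symm (I := I) (n := ∞) x).comp h2 fun z hz => ?_
      have h3 : Ψ.symm (h z) ∈ U := hΨU (Ψ.map_target (h1 z hz))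
      simpa [extChartAt, U, c, h, I.range_eq_univ] using h3
  · rw [hφs]; exact ⟨hx, hΨx⟩
  · rw [hφt]; exact hconv
  · intro y hy
    have h1 : φ.extend I y = Ψ (h (c y)) := I.right_inv' (by simp [I.range_eq_univ])
    rw [h1, hp]
    rw [hφs] at hy
    change f (c.symm (h.symm (h (c y)))) = f y
    rw [h.symm_apply_apply, c.left_inv hy.1]

/-- The derivative of a linear map applied to a manifold map. -/
theorem mfderiv_clm_comp_apply {W : Type*} [NormedAddCommGroup W] [NormedSpace ℝ W] {f : M → V}
    {x : M} (hf : MDifferentiableAt I 𝓘(ℝ, V) f x) (A : V →L[ℝ] W) (v : TangentSpace I x) :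
    mfderiv I 𝓘(ℝ, W) (fun y => A (f y)) x v = A (mfderiv I 𝓘(ℝ, V) f x v) :=
  DFunLike.congr_fun (A.hasMFDerivAt.comp x hf.hasMFDerivAt).mfderiv v

end FlatChart

/-! ### Fibres of a submersion onto ℝᵏ and the foliation by their components -/

section Fibers

variable {E H M : Type*} [NormedAddCommGroup E] [NormedSpace ℝ E] [FiniteDimensional ℝ E]
  [TopologicalSpace H] {I : ModelWithCorners ℝ E H} [I.Boundaryless]
  [TopologicalSpace M] [ChartedSpace H M] [IsManifold I ∞ M] {k : ℕ}

/-- The fibres of a submersion onto `ℝᵏ` are embedded submanifolds of codimension `k`. -/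
theorem ContMDiff.isEmbeddedSubmanifold_fiber {f : M → Fin k → ℝ}
    (hf : ContMDiff I 𝓘(ℝ, Fin k → ℝ) ∞ f)
    (hs : ∀ x, Function.Surjective (mfderiv I 𝓘(ℝ, Fin k → ℝ) f x)) (c : Fin k → ℝ) :
    IsEmbeddedSubmanifold I (f ⁻¹' {c}) k := by
  intro x hx
  obtain ⟨φ, hφ, hxφ, -, p, hp, hpf⟩ := hf.exists_flat_chart x (hs x)
  refine ⟨φ, hφ, hxφ, p, hp, fun y hy => ?_⟩
  rw [hpf y hy, hpf x hxφ, Set.mem_preimage, Set.mem_singleton_iff, show f x = c from hx]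

/-- A slice of a flat chart with convex image is path connected. -/
theorem joinedIn_fiber_of_flat_chart {V : Type*} [NormedAddCommGroup V] [NormedSpace ℝ V]
    {f : M → V} {φ : OpenPartialHomeomorph M H}
    (hconv : Convex ℝ (φ.extend I).target) {p : E →L[ℝ] V}
    (hp : ∀ y ∈ φ.source, p (φ.extend I y) = f y) {y z : M} (hy : y ∈ φ.source)
    (hz : z ∈ φ.source) (hyz : f z = f y) : JoinedIn (f ⁻¹' {f y}) y z := by
  let e := φ.extend I
  have hsrc : ∀ w, w ∈ e.source ↔ w ∈ φ.source := fun w => by rw [φ.extend_source]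
  -- In the chart the fibre is a convex set cut by an affine subspace, hence convex.
  let T : Set E := e.target ∩ p ⁻¹' {f y}
  have hT : Convex ℝ T := hconv.inter ((convex_singleton _).linear_preimage p.toLinearMap)
  have hmem : ∀ w ∈ φ.source, f w = f y → e w ∈ T := fun w hw hfw =>
    ⟨e.map_source ((hsrc w).2 hw), by
      rw [Set.mem_preimage, Set.mem_singleton_iff, ← hfw]; exact hp w hw⟩
  have hpath : IsPathConnected (e.symm '' T) :=
    (hT.isPathConnected ⟨_, hmem y hy rfl⟩).image'
      ((φ.continuousOn_extend_symm (I := I)).mono Set.inter_subset_left)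
  have hin : ∀ w ∈ φ.source, f w = f y → w ∈ e.symm '' T := fun w hw hfw =>
    ⟨e w, hmem w hw hfw, e.left_inv ((hsrc w).2 hw)⟩
  refine (hpath.joinedIn y (hin y hy rfl) z (hin z hz hyz)).mono ?_
  rintro _ ⟨w, ⟨hw, hpw⟩, rfl⟩
  have h1 := hp _ ((hsrc _).1 (e.map_target hw))
  rw [show φ.extend I (e.symm w) = w from e.right_inv hw] at h1
  rw [Set.mem_preimage, Set.mem_singleton_iff, ← h1]
  exact hpw

/-- The connected components of the fibres of a submersion onto `ℝᵏ` are the leaves of a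
foliation. -/
theorem ContMDiff.isFoliation_fibers {f : M → Fin k → ℝ}
    (hf : ContMDiff I 𝓘(ℝ, Fin k → ℝ) ∞ f)
    (hs : ∀ x, Function.Surjective (mfderiv I 𝓘(ℝ, Fin k → ℝ) f x)) :
    IsFoliation I {L : Set M | ∃ x, L = connectedComponentIn (f ⁻¹' {f x}) x} k where
  partition := by
    refine ⟨?_, fun x => ⟨connectedComponentIn (f ⁻¹' {f x}) x,
      ⟨⟨x, rfl⟩, mem_connectedComponentIn rfl⟩, ?_⟩⟩
    · rintro ⟨x, hx⟩
      have : x ∈ connectedComponentIn (f ⁻¹' {f x}) x := mem_connectedComponentIn rfl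
      rw [← hx] at this
      exact this
    · rintro L ⟨⟨y, rfl⟩, hxy⟩
      have hfx : f x = f y := connectedComponentIn_subset (f ⁻¹' {f y}) y hxy
      rw [hfx]
      exact connectedComponentIn_eq hxy
  isPathConnected := by
    rintro _ ⟨x, rfl⟩
    set S := f ⁻¹' {f x}
    have hxS : x ∈ connectedComponentIn S x := mem_connectedComponentIn rfl
    have hSL : ∀ y ∈ connectedComponentIn S x, f y = f x := fun y hy =>
      connectedComponentIn_subset S x hy
    have hjoin : ∀ y ∈ connectedComponentIn S x, ∀ z, JoinedIn S y z →
        JoinedIn (connectedComponentIn S x) y z := by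
      intro y hy z hyz
      obtain ⟨γ, hγ⟩ := hyz
      refine ⟨γ, fun t => ?_⟩
      rw [connectedComponentIn_eq hy]
      refine (isPreconnected_range γ.continuous).subset_connectedComponentIn ⟨0, γ.source⟩ ?_
        ⟨t, rfl⟩
      rintro _ ⟨s, rfl⟩
      exact hγ s
    refine ⟨x, hxS, fun {y} hy => ?_⟩
    -- Being joined inside the component is symmetric and transitive, and it holds between nearby
    -- points because slices of flat charts are path connected; on a preconnected set such a
    -- relation is total.
    refine isPreconnected_connectedComponentIn.induction₂
      (P := fun a b => JoinedIn (connectedComponentIn S x) a b) ?_ ?_ ?_ hxS hy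
    · intro a ha
      obtain ⟨φ, -, haφ, hconv, p, -, hpf⟩ := hf.exists_flat_chart a (hs a)
      filter_upwards [mem_nhdsWithin_of_mem_nhds (φ.open_source.mem_nhds haφ),
        self_mem_nhdsWithin] with b hb hbS
      have h := joinedIn_fiber_of_flat_chart hconv hpf haφ hb ((hSL b hbS).trans (hSL a ha).symm)
      rw [hSL a ha] at h
      exact hjoin a ha b h
    · exact fun a b c _ _ _ hab hbc => hab.trans hbc
    · exact fun a b _ _ h => h.symm
  flat_chart := by
    intro x
    obtain ⟨φ, hφ, hxφ, hconv, p, hp, hpf⟩ := hf.exists_flat_chart x (hs x)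
    refine ⟨φ, hφ, hxφ, hconv, p, hp, ?_⟩
    rintro _ ⟨a, rfl⟩
    -- A fibre meets the flat chart in a single path connected slice, so a component meeting the
    -- chart contains that whole slice: `C` is a singleton or empty.
    by_cases h : ∃ b ∈ φ.source, b ∈ connectedComponentIn (f ⁻¹' {f a}) a
    · obtain ⟨b, hb, hba⟩ := h
      have hfb : f b = f a := connectedComponentIn_subset (f ⁻¹' {f a}) a hba
      refine ⟨{f a}, Set.countable_singleton _, fun y hy => ?_⟩
      rw [hpf y hy, Set.mem_singleton_iff]
      refine ⟨fun hya => connectedComponentIn_subset (f ⁻¹' {f a}) a hya, fun hya => ?_⟩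
      obtain ⟨γ, hγ⟩ := joinedIn_fiber_of_flat_chart hconv hpf hb hy (hya.trans hfb.symm)
      rw [hfb] at hγ
      rw [connectedComponentIn_eq hba]
      refine (isPreconnected_range γ.continuous).subset_connectedComponentIn ⟨0, γ.source⟩ ?_
        ⟨1, γ.target⟩
      rintro _ ⟨s, rfl⟩
      exact hγ s
    · refine ⟨∅, Set.countable_empty, fun y hy => ?_⟩
      simp only [Set.mem_empty_iff_false, iff_false]
      exact fun hya => h ⟨y, hy, hya⟩

end Fibers

/-! ### Generators of horizontal gauge symmetries -/

namespace NonholonomicSystem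

variable {E Q EG G : Type*} [NormedAddCommGroup E] [NormedSpace ℝ E]
  [TopologicalSpace Q] [ChartedSpace E Q] [IsManifold 𝓘(ℝ, E) ∞ Q]
  [NormedAddCommGroup EG] [NormedSpace ℝ EG]
  [TopologicalSpace G] [ChartedSpace EG G] [Group G] [LieGroup 𝓘(ℝ, EG) ∞ G]
  [MulAction G Q] [ContMDiffSMul 𝓘(ℝ, EG) 𝓘(ℝ, E) ∞ G Q]
  {𝒩 : NonholonomicSystem E Q}

/-- A symmetry group of the Lagrangian acts by isometries of the kinetic energy metric. -/
theorem IsSymmetry.inner_mfderiv (h : 𝒩.IsSymmetry G) (g : G) (q : Q)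
    (u v : TangentSpace 𝓘(ℝ, E) q) :
    𝒩.κ.inner (g • q) (mfderiv 𝓘(ℝ, E) 𝓘(ℝ, E) (fun x : Q => g • x) q u)
      (mfderiv 𝓘(ℝ, E) 𝓘(ℝ, E) (fun x : Q => g • x) q v) = 𝒩.κ.inner q u v := by
  set A : TangentSpace 𝓘(ℝ, E) q →L[ℝ] TangentSpace 𝓘(ℝ, E) (g • q) :=
    mfderiv 𝓘(ℝ, E) 𝓘(ℝ, E) (fun x : Q => g • x) q
  have hL : ∀ w : TangentSpace 𝓘(ℝ, E) q,
      (1 / 2) * 𝒩.κ.inner (g • q) (A w) (A w) - 𝒩.U (g • q) =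
        (1 / 2) * 𝒩.κ.inner q w w - 𝒩.U q := fun w => (h g).1 ⟨q, w⟩
  have hq : ∀ w, 𝒩.κ.inner (g • q) (A w) (A w) = 𝒩.κ.inner q w w := by
    intro w
    -- The zero vector isolates invariance of the potential; invariance of the quadratic form
    -- follows, and then polarization applies.
    have h0 := hL 0
    have h1 := hL w
    simp only [map_zero, mul_zero] at h0
    linarith
  have h1 := hq (u + v)
  have h2 := hq u
  have h3 := hq v
  have h4 := 𝒩.κ.symm q u v
  have h5 := 𝒩.κ.symm (g • q) (A u) (A v)
  simp only [map_add, add_apply] at h1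
  linarith

variable {k : ℕ} {ζ : Fin k → Q → GroupLieAlgebra 𝓘(ℝ, EG) G}

/-- The infinitesimal generators of invariant horizontal gauge momenta are `G`-invariant vector
fields. -/
theorem IsHorizontalGaugeSymmetryBasis.generator_smul (h : 𝒩.IsHorizontalGaugeSymmetryBasis ζ)
    (hsymm : 𝒩.IsSymmetry G) (i : Fin k) (g : G) (q : Q) :
    generator (EG := EG) (G := G) (E := E) (g • q) (ζ i (g • q)) =
      mfderiv 𝓘(ℝ, E) 𝓘(ℝ, E) (fun x : Q => g • x) q (generator q (ζ i q)) := by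
  set A : TangentSpace 𝓘(ℝ, E) q →L[ℝ] TangentSpace 𝓘(ℝ, E) (g • q) :=
    mfderiv 𝓘(ℝ, E) 𝓘(ℝ, E) (fun x : Q => g • x) q with hA
  set Zg := generator (EG := EG) (G := G) (E := E) (g • q) (ζ i (g • q)) with hZg
  set Z := generator (EG := EG) (G := G) (E := E) q (ζ i q) with hZ
  -- `v` is the generator at g·q transported back to q; it lies in D because g⁻¹ preserves D, and it
  -- remains to see that it equals `Z`.
  let v : TangentSpace 𝓘(ℝ, E) q := A.inverse Zg
  have hAv : A v = Zg := by
    have h1 := DFunLike.congr_fun (mfderiv_comp_inv_smul EG (E := E) g q) Zg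
    change A (A.inverse Zg) = Zg
    rw [hA, mfderiv_smul_inverse EG g q]
    exact h1
  have hvD : v ∈ 𝒩.D q := by
    have key : ∀ (y : Q) (w : E), y = q → w ∈ 𝒩.D y → w ∈ 𝒩.D q := by
      rintro y w rfl hw; exact hw
    have h1 := (hsymm g⁻¹).2 (g • q) Zg (h.mem i (g • q)).1
    have h2 := key _ _ (inv_smul_smul g q) h1
    have h3 : v = (mfderiv 𝓘(ℝ, E) 𝓘(ℝ, E) (fun x : Q => g⁻¹ • x) (g • q) : E →L[ℝ] E) Zg :=
      DFunLike.congr_fun (mfderiv_smul_inverse EG (E := E) g q) Zg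
    rw [h3]; exact h2
  have hD : v - Z ∈ 𝒩.D q := sub_mem hvD (h.mem i q).1
  -- The covectors of ℳ over q are κ(u, ·) with u in D, so invariance of Jᵢ there reads κ(u, v) =
  -- κ(u, Z). Taking u = v − Z in D and using positivity gives v = Z.
  have hu : ∀ u ∈ 𝒩.D q, 𝒩.κ.inner q u (v - Z) = 0 := by
    intro u hu
    have h1 := h.invariant i g (𝒩.legendre ⟨q, u⟩) ⟨⟨q, u⟩, hu, rfl⟩
    simp only [gaugeMomentum, momentumMap_apply] at h1
    have h2 : 𝒩.κ.inner q u v = 𝒩.κ.inner q u Z := h1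
    rw [map_sub, h2, sub_self]
  have hz : v - Z = 0 := by
    by_contra hne
    exact (𝒩.κ.pos q (v - Z) hne).ne' (hu _ hD)
  rw [← hAv, sub_eq_zero.1 hz]

/-- The vector fields generated by smooth `𝔤`-valued functions are smooth. -/
theorem IsHorizontalGaugeSymmetryBasis.contMDiff_generator
    (h : 𝒩.IsHorizontalGaugeSymmetryBasis ζ) (a : Fin k → ℝ) :
    ContMDiff 𝓘(ℝ, E) 𝓘(ℝ, E).tangent ∞
      (fun x => (⟨x, generator x (∑ i, a i • ζ i x)⟩ : TangentBundle 𝓘(ℝ, E) Q)) := by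
  intro q
  apply contMDiffAt_generator
  let A : (Fin k → EG) →L[ℝ] EG := ∑ i, a i • ContinuousLinearMap.proj i
  let ζ' : Q → Fin k → EG := fun x i => ζ i x
  have h1 : ContMDiff 𝓘(ℝ, E) 𝓘(ℝ, Fin k → EG) ∞ ζ' := contMDiff_pi_space.2 h.contMDiff
  have h2 := (A.contDiff (n := ∞)).contMDiff.comp h1
  refine (h2 q).congr_of_eventuallyEq (Filter.Eventually.of_forall fun x => ?_)
  simp only [A, Function.comp, sum_apply, smul_apply,
    ContinuousLinearMap.proj_apply]
  rfl

/-- Functionally independent gauge momenta have linearly independent generators. -/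
theorem IsHorizontalGaugeSymmetryBasis.linearIndependent_generator [FiniteDimensional ℝ E]
    (h : 𝒩.IsHorizontalGaugeSymmetryBasis ζ) (q : Q) :
    LinearIndependent ℝ (fun i => generator (EG := EG) (G := G) (E := E) q (ζ i q)) := by
  rw [Fintype.linearIndependent_iff]
  intro a ha
  have hsum : ∀ x : Q, generator (EG := EG) (G := G) (E := E) x (∑ i, a i • ζ i x) =
      ∑ i, a i • generator (EG := EG) (G := G) (E := E) x (ζ i x) := fun x => by
    simp only [map_sum, map_smul]
  -- The zero covector lies in ℳ. If Σ aᵢZᵢ vanishes at q, then Σ aᵢJᵢ is critical there, so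
  -- functional independence forces a = 0.
  let m : CotangentBundle E Q := ⟨q, 0⟩
  have hm : m ∈ 𝒩.constraintManifold :=
    ⟨⟨q, 0⟩, (𝒩.D q).zero_mem, by simp [legendre, m]⟩
  refine congrFun (h.independent m hm a fun v _ => ?_)
  have h0 := mfderiv_pairing_eq_zero (h.contMDiff_generator a) (q := q) (by rw [hsum, ha])
  have hsm : ∀ i, ContMDiff (cotangentModel E) 𝓘(ℝ, ℝ) ∞ (gaugeMomentum (E := E) (ζ i)) := by
    intro i
    have h1 := contMDiff_pairing (h.contMDiff_generator (Pi.single i 1))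
    convert h1 using 2 with α
    simp [gaugeMomentum, momentumMap_apply, Pi.single_apply]
  let f : CotangentBundle E Q → Fin k → ℝ := fun α i => gaugeMomentum (ζ i) α
  have hf : ContMDiff (cotangentModel E) 𝓘(ℝ, Fin k → ℝ) ∞ f := contMDiff_pi_space.2 hsm
  have hfd := hf.mdifferentiableAt (x := m) (by simp)
  have hi : ∀ i, cotangentDiff (gaugeMomentum (ζ i)) m v =
      (mfderiv (cotangentModel E) 𝓘(ℝ, Fin k → ℝ) f m v : Fin k → ℝ) i := fun i =>
    mfderiv_clm_comp_apply hfd (ContinuousLinearMap.proj (R := ℝ) (φ := fun _ : Fin k => ℝ) i) v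
  let A : (Fin k → ℝ) →L[ℝ] ℝ := ∑ i, a i • ContinuousLinearMap.proj i
  have hA := mfderiv_clm_comp_apply hfd A v
  have hfun : (fun α => A (f α)) = fun α : CotangentBundle E Q =>
      (α.2 (generator α.proj (∑ i, a i • ζ i α.proj)) : ℝ) := by
    ext α
    rw [hsum, map_sum]
    simp [A, f, gaugeMomentum, momentumMap_apply]
  rw [hfun, h0] at hA
  simp only [hi]
  have h2 : A (mfderiv (cotangentModel E) 𝓘(ℝ, Fin k → ℝ) f m v) = 0 := hA.symm
  have hAr : ∀ r : Fin k → ℝ, A r = ∑ i, a i * r i := fun r => by simp [A]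
  exact (hAr _).symm.trans h2

end NonholonomicSystem

/-! ### Dual frames and prescribed linear forms -/

section DualFrame

variable {X V : Type*} [AddCommGroup V] [Module ℝ V] {k : ℕ} {η : Fin k → X → V}

theorem dualFrame_apply {x : X} (hi : LinearIndependent ℝ fun j => η j x)
    (hs : ⊤ ≤ Submodule.span ℝ (Set.range fun j => η j x)) (i j : Fin k) :
    dualFrame η i x (η j x) = if i = j then 1 else 0 := by
  rw [dualFrame, dif_pos ⟨hi, hs⟩]
  have := (Module.Basis.mk hi hs).repr_self j
  rw [Module.Basis.mk_apply] at this
  rw [Module.Basis.coord_apply, this, Finsupp.single_apply]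
  simp [eq_comm]

/-- A linear form is the combination of the dual frame with its values on the frame as
coefficients. -/
theorem eq_sum_smul_dualFrame_iff {x : X} (hi : LinearIndependent ℝ fun j => η j x)
    (hs : ⊤ ≤ Submodule.span ℝ (Set.range fun j => η j x)) (c : Fin k → ℝ)
    (φ : Module.Dual ℝ V) :
    φ = (∑ i, c i • dualFrame η i) x ↔ ∀ j, φ (η j x) = c j := by
  have hv : ∀ j, (∑ i, c i • dualFrame η i) x (η j x) = c j := by
    intro j
    simp [Finset.sum_apply, LinearMap.sum_apply, dualFrame_apply hi hs]
  constructor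
  · rintro rfl j
    exact hv j
  · intro h
    refine (Module.Basis.mk hi hs).ext fun j => ?_
    rw [Module.Basis.mk_apply, h, hv]

end DualFrame

/-- A linear form on a finite dimensional space may be prescribed on independent vectors. -/
theorem LinearIndependent.exists_continuousLinearMap_eq {ι V : Type*} [NormedAddCommGroup V]
    [NormedSpace ℝ V] [FiniteDimensional ℝ V] {v : ι → V} (hv : LinearIndependent ℝ v)
    (r : ι → ℝ) : ∃ β : V →L[ℝ] ℝ, ∀ i, β (v i) = r i := by
  obtain ⟨g, hg⟩ := ((Module.Basis.span hv).constr ℝ r).exists_extend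
  refine ⟨LinearMap.toContinuousLinearMap g, fun i => ?_⟩
  have h1 := LinearMap.congr_fun hg (Module.Basis.span hv i)
  rw [Module.Basis.constr_basis] at h1
  rw [← h1, LinearMap.comp_apply, Submodule.subtype_apply, Module.Basis.span_apply hv i]
  rfl

/-! ### The submersion defined by a family of independent vector fields -/

section Frame

variable {E Q : Type*} [NormedAddCommGroup E] [NormedSpace ℝ E] [FiniteDimensional ℝ E]
  [TopologicalSpace Q] [ChartedSpace E Q] [IsManifold 𝓘(ℝ, E) ∞ Q] {k : ℕ}
  {Y : Fin k → ∀ x : Q, TangentSpace 𝓘(ℝ, E) x}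

/-- The pairings of a covector with a family of vector fields. -/
def pairings (Y : Fin k → ∀ x : Q, TangentSpace 𝓘(ℝ, E) x) (α : CotangentBundle E Q) :
    Fin k → ℝ :=
  fun i => α.2 (Y i α.proj)

theorem contMDiff_pairings (hY : ∀ i, ContMDiff 𝓘(ℝ, E) 𝓘(ℝ, E).tangent ∞
      (fun x => (⟨x, Y i x⟩ : TangentBundle 𝓘(ℝ, E) Q))) :
    ContMDiff (cotangentModel E) 𝓘(ℝ, Fin k → ℝ) ∞ (pairings Y) :=
  contMDiff_pi_space.2 fun i => contMDiff_pairing (hY i)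

/-- The pairings of covectors with independent vector fields form a submersion. -/
theorem surjective_mfderiv_pairings (hY : ∀ i, ContMDiff 𝓘(ℝ, E) 𝓘(ℝ, E).tangent ∞
      (fun x => (⟨x, Y i x⟩ : TangentBundle 𝓘(ℝ, E) Q)))
    (hind : ∀ x, LinearIndependent ℝ fun i => Y i x) (α : CotangentBundle E Q) :
    Function.Surjective (mfderiv (cotangentModel E) 𝓘(ℝ, Fin k → ℝ) (pairings Y) α) := by
  intro r
  -- Vertical directions suffice: choose a covector `β` with values `r` on the frame and move α
  -- along it.
  obtain ⟨β, hβ⟩ := LinearIndependent.exists_continuousLinearMap_eq (V := E) (hind α.proj) r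
  obtain ⟨w, hw⟩ := exists_forall_mfderiv_pairing α β
  refine ⟨w, funext fun i => ?_⟩
  have h1 := mfderiv_clm_comp_apply ((contMDiff_pairings hY).mdifferentiableAt (x := α) (by simp))
    (ContinuousLinearMap.proj (R := ℝ) (φ := fun _ : Fin k => ℝ) i) w
  exact h1.symm.trans ((hw _ (hY i)).trans (hβ i))

end Frame

/-! ### The reduced gauge symmetries as an invariant smooth frame of 𝔣 -/

section Reduction

variable {E Q EG G E' Q' EF F : Type*}
  [NormedAddCommGroup E] [NormedSpace ℝ E] [FiniteDimensional ℝ E]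
  [TopologicalSpace Q] [ChartedSpace E Q] [IsManifold 𝓘(ℝ, E) ∞ Q]
  [NormedAddCommGroup EG] [NormedSpace ℝ EG]
  [TopologicalSpace G] [ChartedSpace EG G] [Group G] [LieGroup 𝓘(ℝ, EG) ∞ G]
  [MulAction G Q] [ContMDiffSMul 𝓘(ℝ, EG) 𝓘(ℝ, E) ∞ G Q]
  [NormedAddCommGroup E'] [NormedSpace ℝ E']
  [TopologicalSpace Q'] [ChartedSpace E' Q'] [IsManifold 𝓘(ℝ, E') ∞ Q']
  [NormedAddCommGroup EF] [NormedSpace ℝ EF] [FiniteDimensional ℝ EF]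
  [TopologicalSpace F] [ChartedSpace EF F] [Group F] [LieGroup 𝓘(ℝ, EF) ∞ F]
  [MulAction F Q'] {GW : Subgroup G} {ρ : Q → Q'} {pr : G →* F}
  {𝒩 : NonholonomicSystem E Q} {k : ℕ} {ζ : Fin k → Q → GroupLieAlgebra 𝓘(ℝ, EG) G}

namespace IsReduction

/-- The generators of `T_1 pr (ζᵢ)` form `F`-invariant vector fields along `ρ`. -/
theorem generator_lieProjection_smul
    (h : IsReduction (EG := EG) (E := E) (EF := EF) (E' := E') GW ρ pr)
    (hζ : 𝒩.IsHorizontalGaugeSymmetryBasis ζ) (hsymm : 𝒩.IsSymmetry G) (i : Fin k) (g : G)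
    (q : Q) :
    generator (EG := EF) (G := F) (E := E') (ρ (g • q)) (lieProjection pr (ζ i (g • q))) =
      (mfderiv 𝓘(ℝ, E') 𝓘(ℝ, E') (fun x : Q' => pr g • x) (ρ q)
        (generator (EG := EF) (G := F) (E := E') (ρ q) (lieProjection pr (ζ i q))) : E') := by
  rw [← h.mfderiv_generator, hζ.generator_smul hsymm, ← h.mfderiv_generator]
  exact h.mfderiv_smul g q _

/-- The partially reduced horizontal gauge symmetries are well defined. -/
theorem reducedSymmetry_apply
    (h : IsReduction (EG := EG) (E := E) (EF := EF) (E' := E') GW ρ pr)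
    (hfree : ∀ (g : G) (q : Q), g • q = q → g = 1)
    (hζ : 𝒩.IsHorizontalGaugeSymmetryBasis ζ) (hsymm : 𝒩.IsSymmetry G) (i : Fin k) (q : Q) :
    reducedSymmetry (EG := EG) (EF := EF) pr h.surjective_base (ζ i) (ρ q) =
      lieProjection pr (ζ i q) := by
  have := h.contMDiffSMul
  set q₀ := Function.surjInv h.surjective_base (ρ q) with hq₀
  have h0 : ρ q₀ = ρ q := Function.surjInv_eq h.surjective_base (ρ q)
  -- Two points of one fibre differ by `w` in G_W, which acts trivially on the quotient.
  -- Equivariance therefore gives equal generators at the same point, and freeness gives equal Lie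
  -- algebra elements.
  obtain ⟨w, hw⟩ := (h.base_eq_iff _ _).1 h0
  have hw : q₀ = (w : G) • q := hw.symm
  have hpw : pr w = 1 := by
    have : (w : G) ∈ pr.ker := by rw [h.ker_eq]; exact w.2
    exact this
  change lieProjection pr (ζ i q₀) = _
  have h1 := h.generator_lieProjection_smul hζ hsymm i w q
  rw [← hw, hpw] at h1
  have h2 : (fun x : Q' => (1 : F) • x) = id := by ext x; simp
  rw [h2, mfderiv_id] at h1
  have key : ∀ (x x' : Q') (ν ν' : GroupLieAlgebra 𝓘(ℝ, EF) F), x' = x →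
      ((generator (EG := EF) (G := F) (E := E') x' ν : E') =
        generator (EG := EF) (G := F) (E := E') x ν') → ν = ν' := by
    rintro _ x ν ν' rfl hν
    exact generator_injective (h.free hfree) x hν
  exact key _ _ _ _ h0 h1

/-- If a combination of the ζᵢ(q) dies in 𝔣, its generator is killed by Tρ and so lies in W; it also
lies in D, and D ∩ W = 0. -/
theorem linearIndependent_lieProjection
    (h : IsReduction (EG := EG) (E := E) (EF := EF) (E' := E') GW ρ pr)
    (hζ : 𝒩.IsHorizontalGaugeSymmetryBasis ζ)
    {W : ∀ q : Q, Submodule ℝ (TangentSpace 𝓘(ℝ, E) q)}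
    (hW : 𝒩.VerticalSymmetryCondition EG W GW) (q : Q) :
    LinearIndependent ℝ fun i =>
      (lieProjection pr (ζ i q) : GroupLieAlgebra 𝓘(ℝ, EF) F) := by
  rw [Fintype.linearIndependent_iff]
  intro a ha
  refine Fintype.linearIndependent_iff.1 (hζ.linearIndependent_generator q) a ?_
  set z := ∑ i, a i • generator (EG := EG) (G := G) (E := E) q (ζ i q) with hz
  have h1 : z = generator (EG := EG) (G := G) (E := E) q (∑ i, a i • ζ i q) := by
    rw [hz, map_sum]; simp only [map_smul]
  have h2 : lieProjection (EG := EG) (EF := EF) pr (∑ i, a i • ζ i q) = 0 := by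
    rw [← ha, map_sum]; simp only [map_smul]
  have h3 : mfderiv 𝓘(ℝ, E) 𝓘(ℝ, E') ρ q z = 0 := by
    rw [h1, h.mfderiv_generator, h2, map_zero]
  have h4 : z ∈ W q := by
    have := (h.mem_tangentVectors_orbit_iff q z).2 h3
    rw [← hW.eq_tangent q] at this
    exact this
  have h5 : z ∈ 𝒩.D q := sum_mem fun i _ => (𝒩.D q).smul_mem _ (hζ.mem i q).1
  exact (Submodule.disjoint_def.1 (hW.isCompl q).disjoint) z h5 h4

/-- Split the generator of a lift ξ of ν as d + w along D ⊕ W. As W is vertical, d lies in S = D ∩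
V, which the k independent generators of the ζᵢ span by dimension. Tρ kills w, and injectivity of
the F-generators returns the relation to 𝔣. -/
theorem span_lieProjection
    (h : IsReduction (EG := EG) (E := E) (EF := EF) (E' := E') GW ρ pr)
    (hfree : ∀ (g : G) (q : Q), g • q = q → g = 1)
    (hζ : 𝒩.IsHorizontalGaugeSymmetryBasis ζ)
    {W : ∀ q : Q, Submodule ℝ (TangentSpace 𝓘(ℝ, E) q)}
    (hW : 𝒩.VerticalSymmetryCondition EG W GW) (q : Q) :
    ⊤ ≤ Submodule.span ℝ (Set.range fun i =>
      (lieProjection pr (ζ i q) : GroupLieAlgebra 𝓘(ℝ, EF) F)) := by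
  have := h.contMDiffSMul
  rintro ν -
  obtain ⟨ξ, rfl⟩ := h.lieProjection_surjective ν
  let Z : Fin k → TangentSpace 𝓘(ℝ, E) q := fun i => generator q (ζ i q)
  have hZ : LinearIndependent ℝ Z := hζ.linearIndependent_generator q
  have hfin : FiniteDimensional ℝ (TangentSpace 𝓘(ℝ, E) q) := inferInstanceAs (FiniteDimensional ℝ E)
  have hS : Submodule.span ℝ (Set.range Z) = 𝒩.D q ⊓ verticalSpace EG G q := by
    refine Submodule.eq_of_le_of_finrank_eq ?_ ?_
    · rw [Submodule.span_le]
      rintro _ ⟨i, rfl⟩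
      exact hζ.mem i q
    · rw [finrank_span_eq_card hZ, Fintype.card_fin, hζ.rank_eq q]
  set v := generator (EG := EG) (G := G) (E := E) q ξ with hv
  have hvV : v ∈ verticalSpace EG G q := ⟨ξ, rfl⟩
  obtain ⟨d, hd, w, hw, hdw⟩ : ∃ d ∈ 𝒩.D q, ∃ w ∈ W q, d + w = v :=
    Submodule.mem_sup.1 (by rw [(hW.isCompl q).sup_eq_top]; exact Submodule.mem_top)
  have hdV : d ∈ verticalSpace EG G q := by
    rw [eq_sub_of_add_eq hdw]
    exact sub_mem hvV (hW.le_vertical q hw)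
  have hdS : d ∈ Submodule.span ℝ (Set.range Z) := by rw [hS]; exact ⟨hd, hdV⟩
  obtain ⟨a, ha⟩ := (Submodule.mem_span_range_iff_exists_fun ℝ).1 hdS
  have hw0 : mfderiv 𝓘(ℝ, E) 𝓘(ℝ, E') ρ q w = 0 := by
    refine (h.mem_tangentVectors_orbit_iff q w).1 ?_
    rw [← hW.eq_tangent q]; exact hw
  have h1 : d = generator (EG := EG) (G := G) (E := E) q (∑ i, a i • ζ i q) := by
    rw [← ha, map_sum]; simp only [map_smul, Z]
  have h2 : generator (EG := EF) (G := F) (E := E') (ρ q) (lieProjection pr ξ) =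
      generator (EG := EF) (G := F) (E := E') (ρ q)
        (lieProjection pr (∑ i, a i • ζ i q)) := by
    rw [← h.mfderiv_generator, ← h.mfderiv_generator, ← h1, ← hv, ← hdw, map_add, hw0, add_zero]
  rw [generator_injective (h.free hfree) (ρ q) h2, map_sum]
  refine Submodule.sum_mem _ fun i _ => ?_
  rw [map_smul]
  exact Submodule.smul_mem _ _ (Submodule.subset_span ⟨i, rfl⟩)

/-- The generators of the partially reduced horizontal gauge symmetries are smooth. -/
theorem contMDiff_generator_reducedSymmetry
    (h : IsReduction (EG := EG) (E := E) (EF := EF) (E' := E') GW ρ pr)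
    (hζ : 𝒩.IsHorizontalGaugeSymmetryBasis ζ) {η : Fin k → Q' → GroupLieAlgebra 𝓘(ℝ, EF) F}
    (hη : ∀ i q, η i (ρ q) = lieProjection pr (ζ i q)) (i : Fin k) :
    ContMDiff 𝓘(ℝ, E') 𝓘(ℝ, E').tangent ∞
      (fun x => (⟨x, generator x (η i x)⟩ : TangentBundle 𝓘(ℝ, E') Q')) := by
  have := h.contMDiffSMul
  intro x
  obtain ⟨q, rfl⟩ := h.surjective_base x
  apply contMDiffAt_generator
  obtain ⟨σ, hσ, hσ0, hσ1⟩ := (h.isSubmersion_base.isSubmersionAt q).exists_section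
  let A : EG →L[ℝ] EF := lieProjection pr
  let z : Q → EG := ζ i
  -- `η i` was defined through an arbitrary choice of preimages; being independent of it, it can be
  -- computed locally along a smooth section.
  have h1 : ContMDiffAt 𝓘(ℝ, E') 𝓘(ℝ, EF) ∞ (A ∘ z ∘ σ) (ρ q) :=
    A.contDiff.contMDiff.contMDiffAt.comp (ρ q) (((hζ.contMDiff i) _).comp (ρ q) hσ)
  refine h1.congr_of_eventuallyEq ?_
  filter_upwards [hσ1] with y hy
  exact (congrArg (η i) hy).symm.trans (hη i (σ y))

end IsReduction

end Reduction

/-! ### Invariance and the level sets of the reduced momentum map -/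

/-- The momentum of a cotangent lifted action against an invariant vector field is invariant. -/
theorem cotangentLift_pairing {EF F E Q : Type*}
    [NormedAddCommGroup EF] [NormedSpace ℝ EF] [TopologicalSpace F] [ChartedSpace EF F] [Group F]
    [LieGroup 𝓘(ℝ, EF) ∞ F]
    [NormedAddCommGroup E] [NormedSpace ℝ E] [TopologicalSpace Q] [ChartedSpace E Q]
    [IsManifold 𝓘(ℝ, E) ∞ Q] [MulAction F Q] [ContMDiffSMul 𝓘(ℝ, EF) 𝓘(ℝ, E) ∞ F Q]
    {Y : ∀ x : Q, TangentSpace 𝓘(ℝ, E) x} {f : F} {α : CotangentBundle E Q}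
    (hY : Y (f • α.proj) = mfderiv 𝓘(ℝ, E) 𝓘(ℝ, E) (fun x : Q => f • x) α.proj (Y α.proj)) :
    ((cotangentLift f α).2 (Y (cotangentLift f α).proj) : ℝ) = α.2 (Y α.proj) := by
  have h1 := DFunLike.congr_fun (mfderiv_inv_smul_comp EF (E := E) f α.proj) (Y α.proj)
  refine congrArg (α.2 : E →L[ℝ] ℝ) ?_
  rw [mfderiv_smul_inverse EF f α.proj]
  exact (congrArg _ hY).trans h1

end

theorem proposition3p1
    {E Q EG G E' Q' EF F : Type*}
    -- the configuration manifold `Q`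
    [NormedAddCommGroup E] [NormedSpace ℝ E] [FiniteDimensional ℝ E]
    [TopologicalSpace Q] [T2Space Q] [SecondCountableTopology Q] [ChartedSpace E Q]
    [IsManifold 𝓘(ℝ, E) ∞ Q]
    -- the Lie group `G`, acting smoothly, properly and freely on `Q`
    [NormedAddCommGroup EG] [NormedSpace ℝ EG] [FiniteDimensional ℝ EG]
    [TopologicalSpace G] [T2Space G] [SecondCountableTopology G] [ChartedSpace EG G]
    [Group G] [LieGroup 𝓘(ℝ, EG) ∞ G]
    [MulAction G Q] [ContMDiffSMul 𝓘(ℝ, EG) 𝓘(ℝ, E) ∞ G Q] [ProperSMul G Q]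
    (hfree : ∀ (g : G) (q : Q), g • q = q → g = 1)
    -- the nonholonomic system with its symmetry
    (𝒩 : NonholonomicSystem E Q) (hsymm : 𝒩.IsSymmetry G)
    (hdim : 𝒩.DimensionAssumption EG G)
    (W : ∀ q : Q, Submodule ℝ (TangentSpace 𝓘(ℝ, E) q)) (GW : Subgroup G)
    (hW : 𝒩.VerticalSymmetryCondition EG W GW)
    -- the horizontal gauge symmetries
    {k : ℕ} (ζ : Fin k → Q → GroupLieAlgebra 𝓘(ℝ, EG) G)
    (hζ : 𝒩.IsHorizontalGaugeSymmetryBasis ζ)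
    -- the reduced manifold `Q' = Q / G_W` and the group `F = G / G_W` acting on it
    [NormedAddCommGroup E'] [NormedSpace ℝ E'] [FiniteDimensional ℝ E']
    [TopologicalSpace Q'] [ChartedSpace E' Q'] [IsManifold 𝓘(ℝ, E') ∞ Q']
    [NormedAddCommGroup EF] [NormedSpace ℝ EF] [FiniteDimensional ℝ EF]
    [TopologicalSpace F] [ChartedSpace EF F] [Group F] [LieGroup 𝓘(ℝ, EF) ∞ F]
    [MulAction F Q']
    (ρ : Q → Q') (pr : G →* F)
    (hred : IsReduction (EG := EG) (E := E) (EF := EF) (E' := E') GW ρ pr) :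
    -- the partially reduced horizontal gauge symmetries, and the dual frame
    let η : Fin k → Q' → GroupLieAlgebra 𝓘(ℝ, EF) F :=
      fun i => reducedSymmetry pr hred.surjective_base (ζ i)
    let μ : Fin k → Q' → Module.Dual ℝ (GroupLieAlgebra 𝓘(ℝ, EF) F) := dualFrame η
    -- they are well defined: `η` does not depend on the points chosen in the fibres of `ρ`
    (∀ i q, η i (ρ q) = lieProjection pr (ζ i q)) ∧
    (∀ i j x, μ i x (η j x) = if i = j then 1 else 0) ∧
    (∀ c : Fin k → ℝ,
      momentumLevelSet (E := E') (∑ i, c i • μ i) =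
        ⋂ i, {α : CotangentBundle E' Q' | gaugeMomentum (η i) α = c i} ∧
      (∀ h : F, ∀ α ∈ momentumLevelSet (E := E') (∑ i, c i • μ i),
        cotangentLift h α ∈ momentumLevelSet (E := E') (∑ i, c i • μ i)) ∧
      IsEmbeddedSubmanifold (cotangentModel E')
        (momentumLevelSet (E := E') (∑ i, c i • μ i)) k) ∧
    IsFoliation (cotangentModel E')
      {L : Set (CotangentBundle E' Q') | ∃ ν ∈ Submodule.span ℝ (Set.range μ),
        ∃ α ∈ momentumLevelSet (E := E') ν,
          L = connectedComponentIn (momentumLevelSet (E := E') ν) α} k := by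
  intro η μ
  have hsmul := hred.contMDiffSMul
  have hη : ∀ i q, η i (ρ q) = lieProjection pr (ζ i q) :=
    hred.reducedSymmetry_apply hfree hζ hsymm
  have hli : ∀ x, LinearIndependent ℝ fun j => η j x := by
    intro x
    obtain ⟨q, rfl⟩ := hred.surjective_base x
    simp only [hη]
    exact hred.linearIndependent_lieProjection hζ hW q
  have hsp : ∀ x, ⊤ ≤ Submodule.span ℝ (Set.range fun j => η j x) := by
    intro x
    obtain ⟨q, rfl⟩ := hred.surjective_base x
    simp only [hη]
    exact hred.span_lieProjection hfree hζ hW q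
  let Y : Fin k → ∀ x : Q', TangentSpace 𝓘(ℝ, E') x := fun i x => generator x (η i x)
  have hY : ∀ i, ContMDiff 𝓘(ℝ, E') 𝓘(ℝ, E').tangent ∞
      (fun x => (⟨x, Y i x⟩ : TangentBundle 𝓘(ℝ, E') Q')) :=
    hred.contMDiff_generator_reducedSymmetry hζ hη
  have hYli : ∀ x, LinearIndependent ℝ fun i => Y i x := fun x =>
    (hli x).map' (generator (EG := EF) (G := F) (E := E') x).toLinearMap
      (LinearMap.ker_eq_bot.2 (generator_injective (hred.free hfree) x))
  have hYinv : ∀ i (f : F) (x : Q'), Y i (f • x) =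
      mfderiv 𝓘(ℝ, E') 𝓘(ℝ, E') (fun y : Q' => f • y) x (Y i x) := by
    intro i f x
    obtain ⟨g, rfl⟩ := hred.surjective_group f
    obtain ⟨q, rfl⟩ := hred.surjective_base x
    have h1 := hred.generator_lieProjection_smul hζ hsymm i g q
    rw [← hη, ← hη, hred.equivariant] at h1
    exact h1
  have hmom : ∀ i (α : CotangentBundle E' Q'), momentumMap α (η i α.proj) = pairings Y α i :=
    fun i α => momentumMap_apply α _
  -- This is the crux: testing on the frame turns a condition with values in 𝔣* that vary with the
  -- base point into constant values of the scalar map `pairings Y`.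
  have hlevel : ∀ (c : Fin k → ℝ) (α : CotangentBundle E' Q'),
      α ∈ momentumLevelSet (E := E') (∑ i, c i • μ i) ↔ pairings Y α = c := by
    intro c α
    refine (eq_sum_smul_dualFrame_iff (hli α.proj) (hsp α.proj) c (momentumMap α)).trans ?_
    simp only [hmom, funext_iff]
  have hset : ∀ c : Fin k → ℝ, momentumLevelSet (E := E') (∑ i, c i • μ i) =
      pairings Y ⁻¹' {c} := fun c => Set.ext (hlevel c)
  have hsm := contMDiff_pairings hY
  have hsurj := surjective_mfderiv_pairings hY hYli
  refine ⟨hη, fun i j x => dualFrame_apply (hli x) (hsp x) i j, fun c => ⟨?_, ?_, ?_⟩, ?_⟩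
  · ext α
    rw [hlevel, Set.mem_iInter, funext_iff]
    exact forall_congr' fun i => by rw [Set.mem_ofPred_eq, gaugeMomentum, hmom]
  · intro f α hα
    rw [hlevel] at hα ⊢
    rw [← hα]
    exact funext fun i => cotangentLift_pairing (EF := EF) (hYinv i f α.proj)
  · rw [hset]
    exact hsm.isEmbeddedSubmanifold_fiber hsurj c
  · convert hsm.isFoliation_fibers hsurj using 1
    ext L
    constructor
    · rintro ⟨ν, hν, α, hα, rfl⟩
      obtain ⟨c, rfl⟩ := (Submodule.mem_span_range_iff_exists_fun ℝ).1 hν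
      refine ⟨α, ?_⟩
      rw [hset, (hlevel c α).1 hα]
    -- Every covector lies on the level set whose coefficients are its own pairings, so all fibres
    -- occur.
    · rintro ⟨α, rfl⟩
      refine ⟨∑ i, pairings Y α i • μ i,
        (Submodule.mem_span_range_iff_exists_fun ℝ).2 ⟨pairings Y α, rfl⟩, α,
        (hlevel _ α).2 rfl, ?_⟩
      rw [hset]
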